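/- Let $\mathcal{C}_n=\operatorname{Av}_n(2143,3142,254613)$ be the set of permutations of $\{1,\dots,n\}$ that avoid each of the patterns $2143$, $3142$ and $254613$ (a permutation $\pi$ avoids $\tau$ if no subsequence of $\pi$ is order isomorphic to $\tau$). Then, as formal power series, $$\sum_{n\ge 0} |\mathcal{C}_n|\,x^n=\frac{3-x-\sqrt{1-6x+x^2}}{2},$$ where $\sqrt{1-6x+x^2}$ denotes the formal power series with constant term $1$ whose square is $1-6x+x^2$. Equivalently, $|\mathcal{C}_0|=1$ and $|\mathcal{C}_{n+1}|=L_n$ for all $n\ge 0$, where $L_0,L_1,L_2,L_3,\ldots=1,2,6,22,\ldots$ are the large Schröder numbers, defined by $L_0=1$ and $L_{n+1}=L_n+\sum_{i=0}^{n}L_iL_{n-i}$. -/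

import Mathlib

/-- The permutation `π` of length `n` contains the pattern `τ` of length `k`: some subsequence of
`π`, taken at positions `f 0 < f 1 < ⋯ < f (k - 1)`, is order isomorphic to `τ`. -/
def ContainsPattern {n k : ℕ} (π : Equiv.Perm (Fin n)) (τ : Equiv.Perm (Fin k)) : Prop :=
  ∃ f : Fin k → Fin n, StrictMono f ∧ ∀ i j : Fin k, π (f i) < π (f j) ↔ τ i < τ j

/-- `Av n T` is the set of permutations of length `n` that avoid every pattern in `T`
(a pattern is a permutation bundled with its length). -/
def Av (n : ℕ) (T : Set (Σ k : ℕ, Equiv.Perm (Fin k))) : Set (Equiv.Perm (Fin n)) :=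
  {π | ∀ τ ∈ T, ¬ ContainsPattern π τ.2}

/-- The pattern 2143; positions and values are shifted to start at 0. -/
def pattern2143 : Equiv.Perm (Fin 4) where
  toFun := ![1, 0, 3, 2]
  invFun := ![1, 0, 3, 2]
  left_inv := by decide
  right_inv := by decide

/-- The pattern 3142; positions and values are shifted to start at 0. -/
def pattern3142 : Equiv.Perm (Fin 4) where
  toFun := ![2, 0, 3, 1]
  invFun := ![1, 3, 0, 2]
  left_inv := by decide
  right_inv := by decide

/-- The pattern 254613; positions and values are shifted to start at 0. -/
def pattern254613 : Equiv.Perm (Fin 6) where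
  toFun := ![1, 4, 3, 5, 0, 2]
  invFun := ![4, 0, 5, 2, 1, 3]
  left_inv := by decide
  right_inv := by decide

/-- The set of patterns `{2143, 3142, 254613}`. -/
def eggeBasis : Set (Σ k : ℕ, Equiv.Perm (Fin k)) :=
  {⟨4, pattern2143⟩, ⟨4, pattern3142⟩, ⟨6, pattern254613⟩}

/-- The ordinary generating function `∑ |Av_n(2143, 3142, 254613)| x ^ n`, as a formal power
series. -/
noncomputable def eggeGF : PowerSeries ℚ :=
  PowerSeries.mk fun n => ((Av n eggeBasis).ncard : ℚ)

/-- `R` is the formal square root of `F` with constant term 1. There is at most one such `R`. -/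
def IsSqrtSeries (F R : PowerSeries ℚ) : Prop :=
  PowerSeries.constantCoeff R = 1 ∧ R ^ 2 = F

/-! Permutations are counted together with a marked increasing prefix. Let A(x,u) count class
members by length and by length of the marked prefix, and let K(x,u) count those marked members in
which, moreover, no marked letter lies between the values of an ascent of the rest (`NoneBetween`).
The wanted series is C = A(x,0).

Cut a class member at its maximum n, and let r - 1 be the largest letter after n (r = 0 if there is
none). Avoidance of 2143 and 3142 forces the form α γ n β, where α is increasing, αβ uses the values
below r and γ the values from r to n - 1. Such a word avoids the three patterns iff αβ and γ do and,
because of 254613, γ is increasing or `NoneBetween α β` holds (`eggeAvoids_insert_block`,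
`exists_block_of_mem_markedSet`). Marking α in αβ makes this recursive; the condition that r - 1
lies in β costs a factor 1 - xu (`card_topSet_succ`). A cut at the first letter gives K = C + xuCK
(`card_markedSet_noneBetween_succ`). The result is an equation for A that involves its values at u =
0 and u = 1 (`rowSeries_functional_equation`).

The equation has a unique solution, as its right side is divisible by x (`SolvesEquation.unique`).
An explicit solution, rational in u and in the series s with x s (2s - 1) = s - 1, is then verified
(`functionalEquation_field`). It gives C = (2s - 1)/s. Since s = (1 + l)/2 for the large Schröder
series l, this is 1 + x l. -/

/-- The list `w` avoids 2143, 3142 and 254613: no sublist of `w` is order isomorphic to one of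
these patterns. -/
structure EggeAvoids (w : List ℕ) : Prop where
  avoids2143 : ∀ a b c d, [b, a, d, c].Sublist w → a < b → b < c → c < d → False
  avoids3142 : ∀ a b c d, [c, a, d, b].Sublist w → a < b → b < c → c < d → False
  avoids254613 : ∀ a b c d e f, [b, e, d, f, a, c].Sublist w →
    a < b → b < c → c < d → d < e → e < f → False

/-- No entry of `α` lies strictly between the values of an ascent (not necessarily of adjacent
entries) of `β`. -/
def NoneBetween (α β : List ℕ) : Prop :=
  ∀ a ∈ α, ∀ b c, [b, c].Sublist β → b < a → a < c → False

/-! ### Avoidance for words: block insertion and skew sums. -/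

theorem EggeAvoids.sublist {v w : List ℕ} (h : EggeAvoids w) (hv : v.Sublist w) : EggeAvoids v :=
  ⟨fun a b c d hs => h.avoids2143 a b c d (hs.trans hv),
   fun a b c d hs => h.avoids3142 a b c d (hs.trans hv),
   fun a b c d e f hs => h.avoids254613 a b c d e f (hs.trans hv)⟩

theorem eggeAvoids_nil : EggeAvoids [] := by
  constructor <;> intros <;> simp_all

theorem eggeAvoids_of_pairwise {w : List ℕ} (h : w.Pairwise (· < ·)) : EggeAvoids w := by
  constructor
  · intro a b c d hs
    have := h.sublist hs
    grind
  · intro a b c d hs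
    have := h.sublist hs
    grind
  · intro a b c d e f hs
    have := h.sublist hs
    grind

theorem exists_sublist_pair_of_not_pairwise {w : List ℕ} (hw : w.Nodup)
    (h : ¬ w.Pairwise (· < ·)) : ∃ x y, [y, x].Sublist w ∧ x < y := by
  rw [List.pairwise_iff_forall_sublist] at h
  push Not at h
  obtain ⟨y, x, hs, hx⟩ := h
  have := hw.sublist hs
  exact ⟨x, y, hs, by grind⟩

/-- The cut points are numbers, so that for a pattern of fixed length `interval_cases` can run
through all splittings. -/
theorem sublist_three_split {l u v w : List ℕ} (h : l.Sublist (u ++ v ++ w)) :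
    ∃ i j, i + j ≤ l.length ∧ (l.take i).Sublist u ∧ ((l.drop i).take j).Sublist v ∧
      ((l.drop i).drop j).Sublist w := by
  obtain ⟨x, y, rfl, hx, hy⟩ := List.sublist_append_iff.1 h
  obtain ⟨x₁, x₂, rfl, h₁, h₂⟩ := List.sublist_append_iff.1 hx
  exact ⟨x₁.length, x₂.length, by simp, by simpa, by simpa, by simpa⟩

/-- An occurrence that used the final `N` would end in its largest letter. All three patterns end in
a letter that is not their largest. -/
theorem sublist_of_sublist_append_max {l γ : List ℕ} {N x : ℕ} (h : (l ++ [x]).Sublist (γ ++ [N]))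
    (hγ : ∀ y ∈ γ, y < N) (hx : ∃ y ∈ l, x < y) : (l ++ [x]).Sublist γ := by
  obtain ⟨y, hy, hxy⟩ := hx
  obtain ⟨l₁, l₂, e, s₁, s₂⟩ := List.sublist_append_iff.1 h
  rcases List.sublist_singleton.1 s₂ with rfl | rfl
  · simpa [e] using s₁
  · obtain ⟨rfl, h⟩ := List.append_inj' e rfl
    have := hγ y (s₁.subset hy)
    simp at h
    omega

/-- How a sublist can meet a block of maximal consecutive values that follows an increasing
prefix. -/
theorem sublist_block_split {l α γ β : List ℕ} (hα : α.Pairwise (· < ·))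
    (hr : ∀ x ∈ α ++ β, ∀ y ∈ γ, x < y) (h : l.Sublist (α ++ γ ++ β)) :
    ∃ i j, i + j ≤ l.length ∧ (l.take i).Pairwise (· < ·) ∧
      (∀ y ∈ (l.drop i).take j, ∀ x ∈ l.take i, x < y) ∧
      (∀ y ∈ (l.drop i).take j, ∀ x ∈ (l.drop i).drop j, x < y) ∧
      (j = 0 → l.Sublist (α ++ β)) ∧ (l.take i).Sublist α ∧ ((l.drop i).take j).Sublist γ ∧
      ((l.drop i).drop j).Sublist β := by
  obtain ⟨i, j, hij, s₁, s₂, s₃⟩ := sublist_three_split h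
  refine ⟨i, j, hij, hα.sublist s₁, fun y hy x hx => hr x ?_ y (s₂.subset hy),
    fun y hy x hx => hr x ?_ y (s₂.subset hy), ?_, s₁, s₂, s₃⟩
  · exact List.mem_append_left _ (s₁.subset hx)
  · exact List.mem_append_right _ (s₃.subset hx)
  · rintro rfl
    simpa using s₁.append s₃

/-- Inserting a block of maximal consecutive values that ends in its maximum after an increasing
prefix. -/
theorem eggeAvoids_insert_block {α γ β : List ℕ} {N : ℕ} (hα : α.Pairwise (· < ·))
    (hr : ∀ x ∈ α ++ β, ∀ y ∈ γ, x < y) (hN : ∀ x ∈ α ++ γ ++ β, x < N)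
    (h₁ : EggeAvoids (α ++ β)) (h₂ : EggeAvoids γ)
    (h₃ : γ.Pairwise (· < ·) ∨ NoneBetween α β) :
    EggeAvoids (α ++ (γ ++ [N]) ++ β) := by
  have hγ : ∀ y ∈ γ, y < N := fun y hy => hN y (by simp [hy])
  have hlow : ∀ x ∈ α ++ β, ∀ y ∈ γ ++ [N], x < y := by
    intro x hx y hy
    rcases List.mem_append.1 hy with hy | hy
    · exact hr x hx y hy
    · rw [List.mem_singleton.1 hy]
      exact hN x (by simp at hx ⊢; tauto)
  constructor
  · intro a b c d hs hab hbc hcd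
    obtain ⟨i, j, hij, p, m₁, m₃, k₀, s₁, s₂, s₃⟩ := sublist_block_split hα hlow hs
    have k₁ : j ≠ 0 := fun hj => h₁.avoids2143 a b c d (k₀ hj) hab hbc hcd
    have k₂ : ¬ (i = 0 ∧ j = 4) := by
      rintro ⟨rfl, rfl⟩
      exact h₂.avoids2143 a b c d
        (sublist_of_sublist_append_max (l := [b, a, d]) s₂ hγ ⟨d, by simp, hcd⟩) hab hbc hcd
    clear hs s₁ s₂ s₃ k₀
    simp only [List.length_cons, List.length_nil] at hij
    have : i ≤ 4 := by omega
    have : j ≤ 4 := by omega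
    -- The letters in the block would be consecutive in the pattern and larger than all its other
    -- letters, and the letters before them would increase. In 2143 and 3142 this rules out every
    -- remaining splitting.
    interval_cases i <;> interval_cases j <;> simp at hij k₁ k₂ p m₁ m₃ <;> omega
  · intro a b c d hs hab hbc hcd
    obtain ⟨i, j, hij, p, m₁, m₃, k₀, s₁, s₂, s₃⟩ := sublist_block_split hα hlow hs
    have k₁ : j ≠ 0 := fun hj => h₁.avoids3142 a b c d (k₀ hj) hab hbc hcd
    have k₂ : ¬ (i = 0 ∧ j = 4) := by
      rintro ⟨rfl, rfl⟩
      exact h₂.avoids3142 a b c d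
        (sublist_of_sublist_append_max (l := [c, a, d]) s₂ hγ ⟨d, by simp, by omega⟩) hab hbc hcd
    clear hs s₁ s₂ s₃ k₀
    simp only [List.length_cons, List.length_nil] at hij
    have : i ≤ 4 := by omega
    have : j ≤ 4 := by omega
    interval_cases i <;> interval_cases j <;> simp at hij k₁ k₂ p m₁ m₃ <;> omega
  · intro a b c d e f hs hab hbc hcd hde hef
    obtain ⟨i, j, hij, p, m₁, m₃, k₀, s₁, s₂, s₃⟩ := sublist_block_split hα hlow hs
    have k₁ : j ≠ 0 := fun hj => h₁.avoids254613 a b c d e f (k₀ hj) hab hbc hcd hde hef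
    have k₂ : ¬ (i = 0 ∧ j = 6) := by
      rintro ⟨rfl, rfl⟩
      exact h₂.avoids254613 a b c d e f
        (sublist_of_sublist_append_max (l := [b, e, d, f, a]) s₂ hγ ⟨f, by simp, by omega⟩)
        hab hbc hcd hde hef
    -- The only splitting of 254613 that the order relations permit is 2 | 546 | 13. The descent 54
    -- lies in `γ`, even if 6 is `N`, and 2 lies between the values of the ascent 13 of `β`.
    have k₃ : ¬ (i = 1 ∧ j = 3) := by
      rintro ⟨rfl, rfl⟩
      rcases h₃ with h | h
      · have := h.sublist (sublist_of_sublist_append_max (l := [e])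
          (((List.prefix_append [e, d] [f]).sublist).trans s₂) hγ ⟨e, by simp, hde⟩)
        simp at this
        omega
      · exact h b (s₁.subset (by simp)) a c s₃ hab hbc
    clear hs s₁ s₂ s₃ k₀
    simp only [List.length_cons, List.length_nil] at hij
    have : i ≤ 6 := by omega
    have : j ≤ 6 := by omega
    interval_cases i <;> interval_cases j <;> simp at hij k₁ k₂ k₃ p m₁ m₃ <;> omega

/-- A descent y x of `γ`, followed by `N`, turns a letter a of `α` between the values of an ascent b
c of `β` into the occurrence a y x N b c of 254613. -/
theorem noneBetween_of_eggeAvoids_insert_block {α γ β : List ℕ} {N : ℕ}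
    (hγ : γ.Nodup) (hr : ∀ x ∈ α ++ β, ∀ y ∈ γ, x < y) (hN : ∀ x ∈ γ, x < N)
    (h : EggeAvoids (α ++ (γ ++ [N]) ++ β)) (hγ' : ¬ γ.Pairwise (· < ·)) : NoneBetween α β := by
  intro a ha b c hbc hba hac
  obtain ⟨x, y, hs, hxy⟩ := exists_sublist_pair_of_not_pairwise hγ hγ'
  have hx : x ∈ γ := hs.subset (by simp)
  have hy : y ∈ γ := hs.subset (by simp)
  have hc : c ∈ β := hbc.subset (by simp)
  refine h.avoids254613 b a c x y N ?_ hba hac (hr c (by simp [hc]) x hx) hxy (hN y hy)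
  exact ((List.singleton_sublist.2 ha).append (hs.append (List.Sublist.refl [N]))).append hbc

/-- The part of a permutation before its maximum: entries below the maximum of the remaining part
increase and precede the other ones. -/
theorem pairwise_of_eggeAvoids_max {δ β : List ℕ} {N m : ℕ} (hδ : (δ ++ N :: β).Nodup)
    (hm : m ∈ β) (hN : ∀ x ∈ δ ++ β, x < N)
    (h : EggeAvoids (δ ++ N :: β)) : δ.Pairwise (fun x y => x < y ∨ m < y) := by
  rw [List.pairwise_iff_forall_sublist]
  intro x y hs
  by_contra hxy
  push Not at hxy
  have hx : x ∈ δ := hs.subset (by simp)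
  have hy : y ∈ δ := hs.subset (by simp)
  have hyx : y ≠ x := by
    rintro rfl
    have := (hδ.sublist (List.sublist_append_left _ _)).sublist hs
    simp at this
  have hym : y ≠ m := by
    rintro rfl
    grind
  have hxm : x ≠ m := by
    rintro rfl
    grind
  -- With y below both x and m, the word x y N m is an occurrence of 2143 if x < m and of 3142 if x
  -- > m.
  have hs' : [x, y, N, m].Sublist (δ ++ N :: β) :=
    hs.append ((List.singleton_sublist.2 hm).cons_cons N)
  have := hN x (by simp [hx])
  have := hN m (by simp [hm])
  rcases lt_or_gt_of_ne hxm with h' | h'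
  · exact h.avoids2143 y x m N hs' (by omega) h' (by omega)
  · exact h.avoids3142 y m x N hs' (by omega) h' (by omega)

/-- A cons onto a skew sum, with the new entry between the two summands. -/
theorem eggeAvoids_cons_skew {a : ℕ} {v w : List ℕ} (hv : ∀ x ∈ v, a < x) (hw : ∀ x ∈ w, x < a)
    (h₁ : EggeAvoids v) (h₂ : EggeAvoids w) : EggeAvoids (a :: (v ++ w)) := by
  have hvw : ∀ y ∈ w, ∀ x ∈ v, y < x := fun y hy x hx => (hw y hy).trans (hv x hx)
  have split : ∀ l : List ℕ, l.Sublist (a :: (v ++ w)) → ∃ i j, i + j ≤ l.length ∧ i ≤ 1 ∧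
      (∀ y ∈ l.take i, ∀ x ∈ (l.drop i).take j, y < x) ∧
      (∀ y ∈ l.take i, ∀ x ∈ (l.drop i).drop j, x < y) ∧
      (∀ y ∈ (l.drop i).drop j, ∀ x ∈ (l.drop i).take j, y < x) ∧
      ((l.drop i).take j).Sublist v ∧ ((l.drop i).drop j).Sublist w := by
    intro l hl
    obtain ⟨i, j, hij, s₁, s₂, s₃⟩ := sublist_three_split (u := [a]) hl
    refine ⟨i, j, hij, ?_, ?_, ?_, fun y hy x hx => hvw y (s₃.subset hy) x (s₂.subset hx), s₂, s₃⟩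
    · have := s₁.length_le
      simp at this
      omega
    · intro y hy x hx
      rw [List.mem_singleton.1 (s₁.subset hy)]
      exact hv x (s₂.subset hx)
    · intro y hy x hx
      rw [List.mem_singleton.1 (s₁.subset hy)]
      exact hw x (s₃.subset hx)
  -- No pattern is a skew sum, so an occurrence without `a` lies in `v` or in `w`. If `a` is its
  -- first letter, its letter 1 falls into `w`, hence so does everything after it; but in each
  -- pattern 1 is followed by a letter larger than the first one.
  constructor
  · intro p q r t hs hpq hqr hrt
    obtain ⟨i, j, hij, hi, m₁, m₂, m₃, s₂, s₃⟩ := split _ hs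
    have k₂ : ¬ (i = 0 ∧ j = 4) := by
      rintro ⟨rfl, rfl⟩
      exact h₁.avoids2143 p q r t s₂ hpq hqr hrt
    have k₃ : ¬ (i = 0 ∧ j = 0) := by
      rintro ⟨rfl, rfl⟩
      exact h₂.avoids2143 p q r t s₃ hpq hqr hrt
    clear hs s₂ s₃
    simp only [List.length_cons, List.length_nil] at hij
    have : j ≤ 4 := by omega
    interval_cases i <;> interval_cases j <;> simp at hij k₂ k₃ m₁ m₂ m₃ <;> omega
  · intro p q r t hs hpq hqr hrt
    obtain ⟨i, j, hij, hi, m₁, m₂, m₃, s₂, s₃⟩ := split _ hs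
    have k₂ : ¬ (i = 0 ∧ j = 4) := by
      rintro ⟨rfl, rfl⟩
      exact h₁.avoids3142 p q r t s₂ hpq hqr hrt
    have k₃ : ¬ (i = 0 ∧ j = 0) := by
      rintro ⟨rfl, rfl⟩
      exact h₂.avoids3142 p q r t s₃ hpq hqr hrt
    clear hs s₂ s₃
    simp only [List.length_cons, List.length_nil] at hij
    have : j ≤ 4 := by omega
    interval_cases i <;> interval_cases j <;> simp at hij k₂ k₃ m₁ m₂ m₃ <;> omega
  · intro p q r t x y hs hpq hqr hrt htx hxy
    obtain ⟨i, j, hij, hi, m₁, m₂, m₃, s₂, s₃⟩ := split _ hs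
    have k₂ : ¬ (i = 0 ∧ j = 6) := by
      rintro ⟨rfl, rfl⟩
      exact h₁.avoids254613 p q r t x y s₂ hpq hqr hrt htx hxy
    have k₃ : ¬ (i = 0 ∧ j = 0) := by
      rintro ⟨rfl, rfl⟩
      exact h₂.avoids254613 p q r t x y s₃ hpq hqr hrt htx hxy
    clear hs s₂ s₃
    simp only [List.length_cons, List.length_nil] at hij
    have : j ≤ 6 := by omega
    interval_cases i <;> interval_cases j <;> simp at hij k₂ k₃ m₁ m₂ m₃ <;> omega

/-! ### Arrangements of an interval with an increasing marked prefix -/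

/-- The arrangements of the interval `lo, …, lo + n - 1`. -/
def arrangements (lo n : ℕ) : Finset (List ℕ) := (List.range' lo n).permutations.toFinset

theorem mem_arrangements {lo n : ℕ} {w : List ℕ} :
    w ∈ arrangements lo n ↔ w.Nodup ∧ ∀ x, x ∈ w ↔ lo ≤ x ∧ x < lo + n := by
  rw [arrangements, List.mem_toFinset, List.mem_permutations]
  constructor
  · intro h
    exact ⟨h.nodup_iff.2 List.nodup_range', fun x => by rw [h.mem_iff, List.mem_range'_1]⟩
  · rintro ⟨h, h'⟩
    exact (List.perm_ext_iff_of_nodup h List.nodup_range').2 fun x => by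
      rw [h', List.mem_range'_1]

theorem length_of_mem_arrangements {lo n : ℕ} {w : List ℕ} (h : w ∈ arrangements lo n) :
    w.length = n := by
  rw [arrangements, List.mem_toFinset, List.mem_permutations] at h
  simpa using h.length_eq

open Classical in
/-- The class members that arrange `lo, …, lo + n - 1`, whose prefix of length `k` is increasing and
satisfies the relation `R` with the rest. -/
noncomputable def markedSet (R : List ℕ → List ℕ → Prop) (lo n k : ℕ) : Finset (List ℕ) :=
  (arrangements lo n).filter fun w =>
    EggeAvoids w ∧ k ≤ n ∧ (w.take k).Pairwise (· < ·) ∧ R (w.take k) (w.drop k)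

/-- The members of `markedSet R 0 n k` whose maximum is not in the marked prefix. -/
noncomputable def topSet (R : List ℕ → List ℕ → Prop) (n k : ℕ) : Finset (List ℕ) :=
  (markedSet R 0 n k).filter fun w => ∀ x ∈ w.take k, x + 1 ≠ n

theorem mem_markedSet {R : List ℕ → List ℕ → Prop} {lo n k : ℕ} {w : List ℕ} :
    w ∈ markedSet R lo n k ↔ w ∈ arrangements lo n ∧ EggeAvoids w ∧ k ≤ n ∧
      (w.take k).Pairwise (· < ·) ∧ R (w.take k) (w.drop k) := by
  simp only [markedSet, Finset.mem_filter]

theorem exists_append_of_le_length {w : List ℕ} {k : ℕ} (h : k ≤ w.length) :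
    ∃ α β, w = α ++ β ∧ α.length = k :=
  ⟨w.take k, w.drop k, (List.take_append_drop k w).symm, by simpa⟩

theorem append_mem_markedSet {R : List ℕ → List ℕ → Prop} {lo n k : ℕ} {α β : List ℕ}
    (h : α.length = k) : α ++ β ∈ markedSet R lo n k ↔
      α ++ β ∈ arrangements lo n ∧ EggeAvoids (α ++ β) ∧ α.Pairwise (· < ·) ∧ R α β := by
  subst h
  simp only [markedSet, Finset.mem_filter, List.take_left', List.drop_left']
  constructor
  · tauto
  · rintro ⟨h₁, h₂, h₃, h₄⟩
    refine ⟨h₁, h₂, ?_, h₃, h₄⟩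
    rw [← length_of_mem_arrangements h₁]
    simp

theorem exists_append_of_mem_markedSet {R : List ℕ → List ℕ → Prop} {lo n k : ℕ} {w : List ℕ}
    (h : w ∈ markedSet R lo n k) : ∃ α β, w = α ++ β ∧ α.length = k := by
  simp only [markedSet, Finset.mem_filter] at h
  exact exists_append_of_le_length (by rw [length_of_mem_arrangements h.1]; exact h.2.2.1)

theorem mem_arrangements_of_mem_markedSet {R : List ℕ → List ℕ → Prop} {lo n k : ℕ} {w : List ℕ}
    (h : w ∈ markedSet R lo n k) : w ∈ arrangements lo n := by
  simp only [markedSet, Finset.mem_filter] at h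
  exact h.1

theorem le_of_mem_markedSet {R : List ℕ → List ℕ → Prop} {lo n k : ℕ} {w : List ℕ}
    (h : w ∈ markedSet R lo n k) : k ≤ n := by
  simp only [markedSet, Finset.mem_filter] at h
  exact h.2.2.1

theorem append_mem_topSet {R : List ℕ → List ℕ → Prop} {n k : ℕ} {α β : List ℕ}
    (h : α.length = k) : α ++ β ∈ topSet R n k ↔
      α ++ β ∈ markedSet R 0 n k ∧ ∀ x ∈ α, x + 1 ≠ n := by
  subst h
  simp [topSet]

theorem exists_append_of_mem_topSet {R : List ℕ → List ℕ → Prop} {n k : ℕ} {w : List ℕ}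
    (h : w ∈ topSet R n k) : ∃ α β, w = α ++ β ∧ α.length = k :=
  exists_append_of_mem_markedSet (Finset.mem_filter.1 h).1

theorem topSet_zero_right (R : List ℕ → List ℕ → Prop) (n : ℕ) :
    topSet R n 0 = markedSet R 0 n 0 := by
  simp [topSet]

theorem markedSet_eq_empty {R : List ℕ → List ℕ → Prop} {lo n k : ℕ} (h : n < k) :
    markedSet R lo n k = ∅ := by
  ext w
  simp only [markedSet, Finset.mem_filter, Finset.notMem_empty, iff_false]
  omega

theorem eggeAvoids_insert_max {α β : List ℕ} {N : ℕ} (hα : α.Pairwise (· < ·))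
    (hN : ∀ x ∈ α ++ β, x < N) (h : EggeAvoids (α ++ β)) : EggeAvoids (α ++ N :: β) := by
  simpa using eggeAvoids_insert_block (γ := []) hα (by simp) (by simpa using hN) h eggeAvoids_nil
    (Or.inl List.Pairwise.nil)

theorem insert_mem_arrangements {α β : List ℕ} {n : ℕ} :
    α ++ n :: β ∈ arrangements 0 (n + 1) ↔ α ++ β ∈ arrangements 0 n := by
  have hp : (α ++ n :: β).Perm (n :: (α ++ β)) := List.perm_middle
  simp only [mem_arrangements, hp.nodup_iff, hp.mem_iff, List.nodup_cons, List.mem_cons]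
  constructor
  · rintro ⟨⟨h₁, h₂⟩, h₃⟩
    refine ⟨h₂, fun x => ?_⟩
    have := h₃ x
    by_cases hx : x = n
    · subst hx; simp [h₁]
    · simp only [hx, false_or] at this
      rw [this]; omega
  · rintro ⟨h₁, h₂⟩
    refine ⟨⟨?_, h₁⟩, fun x => ?_⟩
    · rw [h₂]; omega
    · rw [h₂]; omega

/-- If the maximum is marked, it ends the increasing prefix. Deleting it is a bijection, because a
maximum inserted after an increasing prefix creates no pattern; `hR` says that `R` does not notice
it. -/
theorem card_topSet_succ {R : List ℕ → List ℕ → Prop}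
    (hR : ∀ α β m, (∀ x ∈ α ++ β, x < m) → (R (α ++ [m]) β ↔ R α β)) (n k : ℕ) :
    (topSet R (n + 1) (k + 1)).card + (markedSet R 0 n k).card =
      (markedSet R 0 (n + 1) (k + 1)).card := by
  rw [topSet]
  refine Eq.trans (congrArg _ ?_) (Finset.card_filter_add_card_filter_not _)
  refine Finset.card_bij (fun w _ => w.take k ++ n :: w.drop k) ?_ ?_ ?_
  · intro w hw
    obtain ⟨α, β, rfl, hk⟩ := exists_append_of_mem_markedSet hw
    obtain ⟨h₁, h₂, h₃, h₄⟩ := (append_mem_markedSet hk).1 hw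
    rw [List.take_left' hk, List.drop_left' hk]
    have hlt : ∀ x ∈ α ++ β, x < n := fun x hx => by
      have := ((mem_arrangements.1 h₁).2 x).1 hx
      omega
    have hk' : (α ++ [n]).length = k + 1 := by simp [hk]
    have e : α ++ n :: β = (α ++ [n]) ++ β := by simp
    rw [Finset.mem_filter, e, append_mem_markedSet hk', List.take_left' hk', ← e]
    refine ⟨⟨insert_mem_arrangements.2 h₁, eggeAvoids_insert_max h₃ hlt h₂, ?_, (hR _ _ _ hlt).2 h₄⟩,
      by simp⟩
    refine List.pairwise_append.2 ⟨h₃, by simp, fun x hx y hy => ?_⟩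
    rw [List.mem_singleton.1 hy]
    exact hlt x (by simp [hx])
  · intro w hw w' hw' e
    obtain ⟨α, β, rfl, hk⟩ := exists_append_of_mem_markedSet hw
    obtain ⟨α', β', rfl, hk'⟩ := exists_append_of_mem_markedSet hw'
    simp only [List.take_left' hk, List.drop_left' hk, List.take_left' hk', List.drop_left' hk'] at e
    obtain ⟨rfl, e⟩ := List.append_inj e (hk.trans hk'.symm)
    simp at e
    rw [e]
  · intro w hw
    rw [Finset.mem_filter] at hw
    obtain ⟨hw, hn⟩ := hw
    obtain ⟨α, β, rfl, hk⟩ := exists_append_of_mem_markedSet hw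
    obtain ⟨h₁, h₂, h₃, h₄⟩ := (append_mem_markedSet hk).1 hw
    rw [List.take_left' hk] at hn
    push Not at hn
    obtain ⟨m, hm, hmn⟩ := hn
    obtain rfl : m = n := by omega
    obtain ⟨α, z, rfl⟩ : ∃ α' z, α = α' ++ [z] :=
      ⟨_, _, (List.dropLast_append_getLast (List.ne_nil_of_mem hm)).symm⟩
    obtain rfl : m = z := by
      have hz := ((mem_arrangements.1 h₁).2 z).1 (by simp)
      rcases List.mem_append.1 hm with h | h
      · have := (List.pairwise_append.1 h₃).2.2 m h z (by simp)
        omega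
      · simpa using h
    have hk' : α.length = k := by simpa using hk
    have e : α ++ [m] ++ β = α ++ m :: β := by simp
    rw [e] at h₁ h₂
    have h₁' := insert_mem_arrangements.1 h₁
    have hlt : ∀ x ∈ α ++ β, x < m := fun x hx => by
      have := ((mem_arrangements.1 h₁').2 x).1 hx
      omega
    refine ⟨α ++ β, (append_mem_markedSet hk').2 ⟨h₁', h₂.sublist ?_,
      h₃.sublist (List.sublist_append_left _ _), (hR _ _ _ hlt).1 h₄⟩, ?_⟩
    · exact (List.Sublist.refl α).append (List.sublist_cons_self _ _)
    · simp [List.take_left' hk', List.drop_left' hk']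

theorem eggeAvoids_map {f : ℕ → ℕ} (hf : StrictMono f) {w : List ℕ} :
    EggeAvoids (w.map f) ↔ EggeAvoids w := by
  constructor
  · intro h
    refine ⟨fun a b c d hs h₁ h₂ h₃ => h.avoids2143 _ _ _ _ (hs.map f) (hf h₁) (hf h₂) (hf h₃),
      fun a b c d hs h₁ h₂ h₃ => h.avoids3142 _ _ _ _ (hs.map f) (hf h₁) (hf h₂) (hf h₃),
      fun a b c d e g hs h₁ h₂ h₃ h₄ h₅ => h.avoids254613 _ _ _ _ _ _ (hs.map f) (hf h₁) (hf h₂)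
        (hf h₃) (hf h₄) (hf h₅)⟩
  · intro h
    refine ⟨?_, ?_, ?_⟩
    · intro a b c d hs h₁ h₂ h₃
      obtain ⟨l, hl, e⟩ := List.sublist_map_iff.1 hs
      obtain ⟨a', b', c', d', rfl⟩ : ∃ a' b' c' d', l = [b', a', d', c'] := by
        have : l.length = 4 := by simpa using (congrArg List.length e).symm
        match l, this with
        | [p, q, r, s], _ => exact ⟨q, p, s, r, rfl⟩
      simp only [List.map_cons, List.map_nil, List.cons.injEq] at e
      obtain ⟨rfl, rfl, rfl, rfl, -⟩ := e
      exact h.avoids2143 _ _ _ _ hl (hf.lt_iff_lt.1 h₁) (hf.lt_iff_lt.1 h₂) (hf.lt_iff_lt.1 h₃)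
    · intro a b c d hs h₁ h₂ h₃
      obtain ⟨l, hl, e⟩ := List.sublist_map_iff.1 hs
      obtain ⟨a', b', c', d', rfl⟩ : ∃ a' b' c' d', l = [c', a', d', b'] := by
        have : l.length = 4 := by simpa using (congrArg List.length e).symm
        match l, this with
        | [p, q, r, s], _ => exact ⟨q, s, p, r, rfl⟩
      simp only [List.map_cons, List.map_nil, List.cons.injEq] at e
      obtain ⟨rfl, rfl, rfl, rfl, -⟩ := e
      exact h.avoids3142 _ _ _ _ hl (hf.lt_iff_lt.1 h₁) (hf.lt_iff_lt.1 h₂) (hf.lt_iff_lt.1 h₃)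
    · intro a b c d e g hs h₁ h₂ h₃ h₄ h₅
      obtain ⟨l, hl, e'⟩ := List.sublist_map_iff.1 hs
      obtain ⟨a', b', c', d', k', g', rfl⟩ :
          ∃ a' b' c' d' k' g', l = [b', k', d', g', a', c'] := by
        have : l.length = 6 := by simpa using (congrArg List.length e').symm
        match l, this with
        | [p, q, r, s, t, u], _ => exact ⟨t, p, u, r, q, s, rfl⟩
      simp only [List.map_cons, List.map_nil, List.cons.injEq] at e'
      obtain ⟨rfl, rfl, rfl, rfl, rfl, rfl, -⟩ := e'
      exact h.avoids254613 _ _ _ _ _ _ hl (hf.lt_iff_lt.1 h₁) (hf.lt_iff_lt.1 h₂)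
        (hf.lt_iff_lt.1 h₃) (hf.lt_iff_lt.1 h₄) (hf.lt_iff_lt.1 h₅)

theorem noneBetween_map {f : ℕ → ℕ} (hf : StrictMono f) {α β : List ℕ} :
    NoneBetween (α.map f) (β.map f) ↔ NoneBetween α β := by
  constructor
  · intro h a ha b c hs h₁ h₂
    exact h _ (List.mem_map_of_mem ha) _ _ (hs.map f) (hf h₁) (hf h₂)
  · intro h a ha b c hs h₁ h₂
    obtain ⟨a, ha', rfl⟩ := List.mem_map.1 ha
    obtain ⟨l, hl, e⟩ := List.sublist_map_iff.1 hs
    obtain ⟨b', c', rfl⟩ : ∃ b' c', l = [b', c'] := by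
      have : l.length = 2 := by simpa using (congrArg List.length e).symm
      match l, this with
      | [p, q], _ => exact ⟨p, q, rfl⟩
    simp only [List.map_cons, List.map_nil, List.cons.injEq] at e
    obtain ⟨rfl, rfl, -⟩ := e
    exact h a ha' _ _ hl (hf.lt_iff_lt.1 h₁) (hf.lt_iff_lt.1 h₂)

theorem card_markedSet_shift {R : List ℕ → List ℕ → Prop}
    (hR : ∀ c α β, R (α.map (c + ·)) (β.map (c + ·)) ↔ R α β) (lo n k : ℕ) :
    (markedSet R lo n k).card = (markedSet R 0 n k).card := by
  have hf : StrictMono (lo + ·) := fun a b h => Nat.add_lt_add_left h lo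
  symm
  have key : ∀ α β : List ℕ, α.length = k → ((α ++ β).map (lo + ·) ∈ markedSet R lo n k ↔
      α ++ β ∈ markedSet R 0 n k) := by
    intro α β hk
    rw [List.map_append, append_mem_markedSet (by simpa), append_mem_markedSet hk,
      ← List.map_append, eggeAvoids_map hf, hR, mem_arrangements, mem_arrangements,
      List.nodup_map_iff hf.injective, List.pairwise_map]
    simp only [Nat.add_lt_add_iff_left]
    refine and_congr (and_congr_right fun _ => ?_) Iff.rfl
    constructor
    · intro h x
      have := h (lo + x)
      rw [List.mem_map_of_injective hf.injective] at this
      rw [this]; omega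
    · intro h x
      rw [List.mem_map]
      constructor
      · rintro ⟨y, hy, rfl⟩
        have := (h y).1 hy
        omega
      · intro hx
        exact ⟨x - lo, (h _).2 (by omega), by omega⟩
  refine Finset.card_bij (fun w _ => w.map (lo + ·)) ?_ ?_ ?_
  · intro w hw
    obtain ⟨α, β, rfl, hk⟩ := exists_append_of_mem_markedSet hw
    exact (key α β hk).2 hw
  · intro w _ w' _ e
    exact List.map_injective_iff.2 hf.injective e
  · intro w hw
    obtain ⟨v, rfl⟩ : ∃ v : List ℕ, v.map (lo + ·) = w := by
      refine ⟨w.map (· - lo), ?_⟩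
      rw [List.map_map]
      conv_rhs => rw [← List.map_id w]
      refine List.map_congr_left fun x hx => ?_
      have := ((mem_arrangements.1 (mem_arrangements_of_mem_markedSet hw)).2 x).1 hx
      simp only [Function.comp, id]
      omega
    obtain ⟨α, β, rfl, hk⟩ := exists_append_of_le_length (w := v) (k := k) (by
      have := length_of_mem_arrangements (mem_arrangements_of_mem_markedSet hw)
      rw [List.length_map] at this
      rw [this]
      exact le_of_mem_markedSet hw)
    exact ⟨α ++ β, (key α β hk).1 hw, rfl⟩

/-! ### Decomposition at the first entry -/

theorem sublist_pair_of_append {b c : ℕ} {β δ : List ℕ} (h : [b, c].Sublist (β ++ δ))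
    (hc : c ∉ δ) : [b, c].Sublist β := by
  obtain ⟨l₁, l₂, e, s₁, s₂⟩ := List.sublist_append_iff.1 h
  rcases List.eq_nil_or_concat' l₂ with rfl | ⟨l, z, rfl⟩
  · simpa [e] using s₁
  · exfalso
    apply hc
    have e' := congrArg List.getLast? e
    rw [← List.append_assoc, List.getLast?_append] at e'
    obtain rfl : c = z := by simpa using e'
    exact s₂.subset (by simp)

/-- Turns an order condition into a concatenation. It splits the unmarked letters at the first
entry, and the letters before the maximum at `r`. -/
theorem eq_filter_append_filter (p : ℕ → Bool) {w : List ℕ}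
    (h : w.Pairwise fun x y => p y → p x) : w = w.filter p ++ w.filter fun x => !p x := by
  induction w with
  | nil => rfl
  | cons a w ih =>
    rw [List.pairwise_cons] at h
    by_cases ha : p a
    · simpa [List.filter_cons, ha] using ih h.2
    · have : ∀ x ∈ w, p x = false := fun x hx => by
        by_contra hp
        exact ha (h.1 x hx (by simpa using hp))
      have h₁ : w.filter p = [] := List.filter_eq_nil_iff.2 fun x hx => by simp [this x hx]
      have h₂ : w.filter (fun x => !p x) = w := List.filter_eq_self.2 fun x hx => by
        simp [this x hx]
      simp [ha, h₁, h₂]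

/-- The relation that imposes no condition on the marked prefix. -/
abbrev NoCondition : List ℕ → List ℕ → Prop := fun _ _ => True

theorem mem_markedSet_zero {lo n : ℕ} {w : List ℕ} :
    w ∈ markedSet NoCondition lo n 0 ↔ w ∈ arrangements lo n ∧ EggeAvoids w := by
  simp [mem_markedSet]

/-- The first letter d is marked, so no ascent of the unmarked rest passes over it: there, the
letters above d precede those below d. Hence the word is d v δ, where δ is any class member on the
values below d and v inherits the other marks. The converse is `eggeAvoids_cons_skew`. -/
theorem card_markedSet_noneBetween_succ (r k : ℕ) :
    (markedSet NoneBetween 0 (r + 1) (k + 1)).card = ∑ d ∈ Finset.range (r + 1),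
      (markedSet NoCondition 0 d 0).card * (markedSet NoneBetween 0 (r - d) k).card := by
  have e : ∀ d ∈ Finset.range (r + 1),
      (markedSet NoCondition 0 d 0).card * (markedSet NoneBetween 0 (r - d) k).card =
      (markedSet NoCondition 0 d 0 ×ˢ markedSet NoneBetween (d + 1) (r - d) k).card := by
    intro d _
    rw [Finset.card_product, card_markedSet_shift (R := NoneBetween)
      (fun c α β => noneBetween_map fun a b h => Nat.add_lt_add_left h c) (d + 1)]
  rw [Finset.sum_congr rfl e, ← Finset.card_sigma]
  symm
  refine Finset.card_bij (fun x _ => x.1 :: (x.2.2 ++ x.2.1)) ?_ ?_ ?_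
  · rintro ⟨d, δ, v⟩ h
    simp only [Finset.mem_sigma, Finset.mem_range, Finset.mem_product, mem_markedSet_zero] at h
    obtain ⟨hd, ⟨hδ, hδ'⟩, hv⟩ := h
    obtain ⟨α, β, rfl, hk⟩ := exists_append_of_mem_markedSet hv
    obtain ⟨h₁, h₂, h₃, h₄⟩ := (append_mem_markedSet hk).1 hv
    rw [mem_arrangements] at hδ h₁
    have hlo : ∀ x ∈ δ, x < d := fun x hx => by have := (hδ.2 x).1 hx; omega
    have hhi : ∀ x ∈ α ++ β, d < x := fun x hx => by have := (h₁.2 x).1 hx; omega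
    have e : d :: (α ++ β ++ δ) = (d :: α) ++ (β ++ δ) := by simp
    change d :: (α ++ β ++ δ) ∈ _
    have hE := eggeAvoids_cons_skew hhi hlo h₂ hδ'
    rw [e] at hE ⊢
    refine (append_mem_markedSet (by simpa using hk)).2 ⟨?_, hE, ?_, ?_⟩
    · rw [← e, mem_arrangements, List.nodup_cons, List.nodup_append]
      refine ⟨⟨?_, h₁.1, hδ.1, fun x hx y hy => ?_⟩, fun x => ?_⟩
      · intro h
        rcases List.mem_append.1 h with h | h
        · exact absurd (hhi d h) (lt_irrefl d)
        · exact absurd (hlo d h) (lt_irrefl d)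
      · have := hhi x hx
        have := hlo y hy
        omega
      · rw [List.mem_cons, List.mem_append, h₁.2, hδ.2]
        omega
    · exact List.pairwise_cons.2 ⟨fun x hx => hhi x (by simp [hx]), h₃⟩
    · intro a ha b c hs hba hac
      have hda : d ≤ a := by
        rcases List.mem_cons.1 ha with rfl | ha
        · exact le_rfl
        · exact (hhi a (by simp [ha])).le
      -- Since c > a ≥ d, the letter c is not in `δ`; neither is b, which precedes it.
      have hs' : [b, c].Sublist β := sublist_pair_of_append hs fun hc => by
        have := hlo c hc
        omega
      rcases List.mem_cons.1 ha with rfl | ha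
      · have := hhi b (by simp [hs'.subset (List.mem_cons_self)])
        omega
      · exact h₄ a ha b c hs' hba hac
  · rintro ⟨d, δ, v⟩ h ⟨d', δ', v'⟩ h' e
    simp only [Finset.mem_sigma, Finset.mem_product] at h h'
    simp only [List.cons.injEq] at e
    obtain ⟨rfl, e⟩ := e
    have l := length_of_mem_arrangements (mem_arrangements_of_mem_markedSet h.2.2)
    have l' := length_of_mem_arrangements (mem_arrangements_of_mem_markedSet h'.2.2)
    obtain ⟨rfl, rfl⟩ := List.append_inj e (l.trans l'.symm)
    rfl
  · intro w hw
    obtain ⟨α', β', rfl, hk⟩ := exists_append_of_mem_markedSet hw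
    obtain ⟨h₁, h₂, h₃, h₄⟩ := (append_mem_markedSet hk).1 hw
    obtain _ | ⟨d, α⟩ := α'
    · simp at hk
    have hk : α.length = k := by simpa using hk
    rw [mem_arrangements] at h₁
    obtain ⟨hnd, hmem⟩ := h₁
    have hdr := (hmem d).1 (by simp)
    have hdβ : d ∉ β' := by
      simp only [List.cons_append, List.nodup_cons, List.mem_append, not_or] at hnd
      exact hnd.1.2
    have hdα : ∀ x ∈ α, d < x := (List.pairwise_cons.1 h₃).1
    have hβ' := eq_filter_append_filter (fun x => decide (d < x)) (w := β') (by
      rw [List.pairwise_iff_forall_sublist]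
      intro x y hs hy
      simp only [decide_eq_true_eq] at hy ⊢
      by_contra hx
      have hxd : x ≠ d := by
        rintro rfl
        exact hdβ (hs.subset (by simp))
      exact h₄ d (by simp) x y hs (by omega) hy)
    set β := β'.filter (fun x => decide (d < x)) with hβ
    set δ := β'.filter (fun x => !decide (d < x)) with hδ
    have hsub : (α ++ β).Sublist (d :: α ++ β') :=
      (List.sublist_cons_self d α).append List.filter_sublist
    have hsub' : δ.Sublist (d :: α ++ β') :=
      List.filter_sublist.trans (List.sublist_append_right _ _)
    refine ⟨⟨d, δ, α ++ β⟩, ?_, ?_⟩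
    · simp only [Finset.mem_sigma, Finset.mem_range, Finset.mem_product, mem_markedSet_zero]
      refine ⟨by omega, ⟨?_, h₂.sublist hsub'⟩, (append_mem_markedSet hk).2
        ⟨?_, h₂.sublist hsub, (List.pairwise_cons.1 h₃).2, ?_⟩⟩
      · rw [mem_arrangements]
        refine ⟨hnd.sublist hsub', fun x => ?_⟩
        rw [hδ, List.mem_filter]
        have := hmem x
        simp only [List.cons_append, List.mem_cons, List.mem_append] at this
        simp only [Bool.not_eq_true', decide_eq_false_iff_not]
        constructor
        · rintro ⟨hx, hx'⟩
          have : x ≠ d := fun h => hdβ (h ▸ hx)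
          omega
        · intro hx
          have h' : x ∉ α := fun h => by have := hdα x h; omega
          rcases this.2 (by omega) with h | h | h
          · omega
          · exact absurd h h'
          · exact ⟨h, by omega⟩
      · rw [mem_arrangements]
        refine ⟨hnd.sublist hsub, fun x => ?_⟩
        rw [List.mem_append, hβ, List.mem_filter]
        have := hmem x
        simp only [List.cons_append, List.mem_cons, List.mem_append] at this
        simp only [decide_eq_true_eq]
        constructor
        · rintro (hx | ⟨hx, hx'⟩)
          · have := hdα x hx
            have := (hmem x).1 (by simp [hx])
            omega
          · have := (hmem x).1 (by simp [hx])
            omega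
        · intro hx
          rcases this.2 (by omega) with h | h | h
          · omega
          · exact Or.inl h
          · exact Or.inr ⟨h, by omega⟩
      · intro a ha b c hs
        exact h₄ a (by simp [ha]) b c (hs.trans List.filter_sublist)
    · simp only [List.cons_append, List.append_assoc]
      rw [← hβ']

/-! ### Decomposition at the maximum -/

open Classical in
/-- The class members `γ` that arrange `r, …, n - 1`, such that the first `j` entries of `γ`
followed by `n` increase. -/
noncomputable def blockSet (r n j : ℕ) : Finset (List ℕ) :=
  (arrangements r (n - r)).filter fun γ =>
    EggeAvoids γ ∧ j ≤ n - r + 1 ∧ ((γ ++ [n]).take j).Pairwise (· < ·)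

open Classical in
/-- The pairs of a marked permutation and a block that can be combined to a class member. -/
noncomputable def blockPairs (r n k j : ℕ) : Finset (List ℕ × List ℕ) :=
  (topSet NoCondition r k ×ˢ blockSet r n j).filter fun p =>
    p.2.Pairwise (· < ·) ∨ NoneBetween (p.1.take k) (p.1.drop k)

theorem mem_blockSet {r n j : ℕ} {γ : List ℕ} : γ ∈ blockSet r n j ↔
    γ ∈ arrangements r (n - r) ∧ EggeAvoids γ ∧ j ≤ n - r + 1 ∧
      ((γ ++ [n]).take j).Pairwise (· < ·) := by
  simp only [blockSet, Finset.mem_filter]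

theorem insert_block_mem_arrangements {r n : ℕ} (hr : r ≤ n) {α β γ : List ℕ}
    (h : α ++ β ∈ arrangements 0 r) (hγ : γ ∈ arrangements r (n - r)) :
    α ++ (γ ++ n :: β) ∈ arrangements 0 (n + 1) := by
  have e : α ++ (γ ++ n :: β) = (α ++ γ) ++ n :: β := by simp
  rw [e, insert_mem_arrangements]
  have hp : (α ++ γ ++ β).Perm ((α ++ β) ++ γ) := by
    simpa using List.Perm.append_left α List.perm_append_comm
  rw [mem_arrangements] at *
  simp only [hp.nodup_iff, hp.mem_iff, List.nodup_append (l₁ := α ++ β), List.mem_append (s := α ++ β)]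
  refine ⟨⟨h.1, hγ.1, fun x hx y hy => ?_⟩, fun x => ?_⟩
  · have := (h.2 x).1 hx
    have := (hγ.2 y).1 hy
    omega
  · rw [h.2, hγ.2]
    omega

/-- The subtraction `i - α.length` is truncated: if the marks end inside `α`, no letter of the block
is marked and the block is unrestricted. -/
theorem insert_block_mem_markedSet {r n i : ℕ} (hr : r ≤ n) {α β γ : List ℕ}
    (h : α ++ β ∈ topSet NoCondition r α.length) (hγ : γ ∈ blockSet r n (i - α.length))
    (hαβ : γ.Pairwise (· < ·) ∨ NoneBetween α β) :
    α ++ (γ ++ n :: β) ∈ markedSet NoCondition 0 (n + 1) i := by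
  obtain ⟨h, -⟩ := (append_mem_topSet rfl).1 h
  obtain ⟨h₁, h₂, h₃, -⟩ := (append_mem_markedSet rfl).1 h
  obtain ⟨g₁, g₂, g₃, g₄⟩ := mem_blockSet.1 hγ
  have lo : ∀ x ∈ α ++ β, x < r := fun x hx => by
    have := ((mem_arrangements.1 h₁).2 x).1 hx
    omega
  have hi : ∀ x ∈ γ, r ≤ x ∧ x < n := fun x hx => by
    have := ((mem_arrangements.1 g₁).2 x).1 hx
    omega
  have hlγ : γ.length = n - r := length_of_mem_arrangements g₁
  have hl : (α ++ β).length = r := length_of_mem_arrangements h₁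
  have ha : α.length ≤ r := by simp at hl; omega
  have hE := eggeAvoids_insert_block (N := n) h₃
    (fun x hx y hy => (lo x hx).trans_le (hi y hy).1) (fun x hx => by
      simp only [List.mem_append] at hx
      rcases hx with (hx | hx) | hx
      · exact (lo x (by simp [hx])).trans_le hr
      · exact (hi x hx).2
      · exact (lo x (by simp [hx])).trans_le hr) h₂ g₂ hαβ
  have ht : (α ++ (γ ++ n :: β)).take i = α.take i ++ (γ ++ [n]).take (i - α.length) := by
    have e : γ ++ n :: β = (γ ++ [n]) ++ β := by simp
    rw [List.take_append, e, List.take_append (l₁ := γ ++ [n])]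
    have : i - α.length - (γ ++ [n]).length = 0 := by
      rw [List.length_append, hlγ, List.length_singleton]
      omega
    rw [this]
    simp
  rw [mem_markedSet, ht]
  refine ⟨insert_block_mem_arrangements hr h₁ g₁, by simpa using hE, by omega, ?_, trivial⟩
  refine List.pairwise_append.2 ⟨h₃.sublist (List.take_sublist _ _), g₄, fun x hx y hy => ?_⟩
  have hx := lo x (by simp [List.mem_of_mem_take hx])
  rcases List.mem_append.1 (List.mem_of_mem_take hy) with hy | hy
  · exact hx.trans_le (hi y hy).1
  · rw [List.mem_singleton.1 hy]
    omega

/-- The decomposition at the maximum: `r` exceeds the entries after the maximum tightly. -/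
theorem exists_block_of_mem_markedSet {n i : ℕ} {w : List ℕ}
    (hw : w ∈ markedSet NoCondition 0 (n + 1) i) :
    ∃ r ≤ n, ∃ α β γ, w = α ++ (γ ++ n :: β) ∧ α.length ≤ r ∧
      α ++ β ∈ topSet NoCondition r α.length ∧ γ ∈ blockSet r n (i - α.length) ∧
      (γ.Pairwise (· < ·) ∨ NoneBetween α β) := by
  simp only [markedSet, Finset.mem_filter] at hw
  obtain ⟨hw, hE, hi, hinc, -⟩ := hw
  have hlen := length_of_mem_arrangements hw
  obtain ⟨hnd, hmem⟩ := mem_arrangements.1 hw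
  obtain ⟨δ, β, rfl⟩ := List.append_of_mem ((hmem n).2 (by omega))
  have hlow : ∀ x ∈ δ ++ β, x < n := by
    intro x hx
    have h₁ := (hmem x).1 (by simp at hx ⊢; tauto)
    have h₂ : x ≠ n := by
      rintro rfl
      have := (List.nodup_middle.1 hnd)
      exact (List.nodup_cons.1 this).1 hx
    omega
  -- `r` is one more than the maximum of `β`, or 0 if `β` is empty.
  obtain ⟨r, hr₁, hr₂, hr₃⟩ : ∃ r, (∀ x ∈ β, x < r) ∧ (r ≠ 0 → r - 1 ∈ β) ∧
      δ.Pairwise (fun x y => x < y ∨ r ≤ y) := by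
    by_cases hβ : β = []
    · subst hβ
      refine ⟨0, by simp, by simp, ?_⟩
      simp [List.pairwise_iff_forall_sublist]
    · obtain ⟨m, hm, hm'⟩ := β.toFinset.exists_max_image id
        (List.toFinset_nonempty_iff _ |>.2 hβ)
      simp only [List.mem_toFinset, id] at hm hm'
      exact ⟨m + 1, fun x hx => Nat.lt_succ_of_le (hm' x hx), fun _ => hm,
        pairwise_of_eggeAvoids_max hnd hm hlow hE⟩
  have hrn : r ≤ n := by
    by_contra h
    have := hlow _ (List.mem_append_right _ (hr₂ (by omega)))
    omega
  have hδ := eq_filter_append_filter (fun x => decide (x < r)) (w := δ) (hr₃.imp (by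
    intro x y h
    simp only [decide_eq_true_eq]
    omega))
  set α := δ.filter (fun x => decide (x < r)) with hα
  set γ := δ.filter (fun x => !decide (x < r)) with hγ
  have hαr : ∀ x ∈ α, x < r := fun x hx => by simpa using (List.mem_filter.1 hx).2
  have hγr : ∀ x ∈ γ, r ≤ x := fun x hx => by simpa using (List.mem_filter.1 hx).2
  have hαi : α.Pairwise (· < ·) := by
    refine (hr₃.filter _).imp_of_mem ?_
    intro x y hx hy h
    have := hαr y hy
    omega
  rw [hδ] at hnd hmem hE hlow hinc hlen
  clear_value α γ
  have e : α ++ γ ++ n :: β = α ++ (γ ++ n :: β) := by simp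
  have e' : α ++ γ ++ n :: β = α ++ (γ ++ [n]) ++ β := by simp
  have hs₁ : (α ++ β).Sublist (α ++ γ ++ n :: β) :=
    (List.sublist_append_left α γ).append (List.sublist_cons_self _ _)
  have hs₂ : γ.Sublist (α ++ γ ++ n :: β) :=
    (List.sublist_append_right α γ).trans (List.sublist_append_left _ _)
  have mem : ∀ x, x < n → (x ∈ α ∨ x ∈ γ ∨ x ∈ β) := by
    intro x hx
    have := (hmem x).2 (by omega)
    simp only [List.mem_append, List.mem_cons] at this
    have : x ≠ n := by omega
    tauto
  have h₁ : α ++ β ∈ arrangements 0 r := by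
    refine mem_arrangements.2 ⟨hnd.sublist hs₁, fun x => ?_⟩
    rw [List.mem_append]
    constructor
    · rintro (h | h)
      · have := hαr x h; omega
      · have := hr₁ x h; omega
    · intro h
      rcases mem x (by omega) with h' | h' | h'
      · exact Or.inl h'
      · have := hγr x h'; omega
      · exact Or.inr h'
  have h₂ : γ ∈ arrangements r (n - r) := by
    refine mem_arrangements.2 ⟨hnd.sublist hs₂, fun x => ?_⟩
    constructor
    · intro h
      have := hγr x h
      have := hlow x (by simp [h])
      omega
    · intro h
      rcases mem x (by omega) with h' | h' | h'
      · have := hαr x h'; omega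
      · exact h'
      · have := hr₁ x h'; omega
  have hl₁ := length_of_mem_arrangements h₁
  have hl₂ := length_of_mem_arrangements h₂
  refine ⟨r, hrn, α, β, γ, by rw [hδ, e], ?_, (append_mem_topSet rfl).2
    ⟨(append_mem_markedSet rfl).2 ⟨h₁, hE.sublist hs₁, hαi, trivial⟩, ?_⟩,
    mem_blockSet.2 ⟨h₂, hE.sublist hs₂, ?_, ?_⟩, ?_⟩
  · simp at hl₁; omega
  · intro x hx hxr
    have h : r - 1 ∈ β := hr₂ (by omega)
    obtain rfl : x = r - 1 := by omega
    exact (List.nodup_append.1 (hnd.sublist hs₁)).2.2 _ hx _ h rfl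
  -- Marks reaching beyond `n` would include `n` followed by a smaller letter.
  · by_contra hcon
    rw [e', List.append_assoc, List.take_append, List.take_append,
      List.take_of_length_le (l := γ ++ [n]) (by simp; omega)] at hinc
    obtain _ | ⟨z, β⟩ := β
    · simp at hl₁
      omega
    · have h := (List.pairwise_append.1 (List.pairwise_append.1 hinc).2.1).2.2 n (by simp) z (by
        obtain ⟨t, ht⟩ : ∃ t, i - α.length - (γ ++ [n]).length = t + 1 :=
          ⟨i - α.length - (γ ++ [n]).length - 1, by simp; omega⟩
        rw [ht]
        simp)
      have := hlow z (by simp)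
      omega
  · rw [e', List.append_assoc, List.take_append, List.take_append] at hinc
    exact (List.pairwise_append.1 (List.pairwise_append.1 hinc).2.1).1
  · by_contra h
    push Not at h
    refine h.2 (noneBetween_of_eggeAvoids_insert_block (N := n) (hnd.sublist hs₂) ?_
      (fun x hx => hlow x (by simp [hx])) (e' ▸ hE) h.1)
    intro x hx y hy
    have := ((mem_arrangements.1 h₁).2 x).1 hx
    have := hγr y hy
    omega

/-- `β` is what follows `n`. As `topSet` keeps the maximum r - 1 out of `α`, it is the maximum of
`β`, so `β` determines `r` and then the length of `α`. -/
theorem insert_block_injective {n r r' : ℕ} {α β γ α' β' γ' : List ℕ}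
    (h : α ++ β ∈ topSet NoCondition r α.length)
    (h' : α' ++ β' ∈ topSet NoCondition r' α'.length)
    (hγ : γ ∈ arrangements r (n - r)) (hγ' : γ' ∈ arrangements r' (n - r'))
    (hr' : r' ≤ n)
    (e : α ++ (γ ++ n :: β) = α' ++ (γ' ++ n :: β')) :
    r = r' ∧ α = α' ∧ β = β' ∧ γ = γ' := by
  obtain ⟨h, ht⟩ := (append_mem_topSet rfl).1 h
  obtain ⟨h', ht'⟩ := (append_mem_topSet rfl).1 h'
  have g := mem_arrangements_of_mem_markedSet h
  have g' := mem_arrangements_of_mem_markedSet h'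
  have hnd := (mem_arrangements.1 (insert_block_mem_arrangements hr' g' hγ')).1
  rw [← List.append_assoc, ← List.append_assoc] at e
  rw [← List.append_assoc] at hnd
  have hn : n ∉ α' ++ γ' ++ β' := (List.nodup_cons.1 (List.nodup_middle.1 hnd)).1
  rw [mem_arrangements] at g g' hγ hγ'
  have key := (List.append_cons_inj_of_notMem (x₁ := α' ++ γ') (z₁ := β') (x₂ := α ++ γ) (z₂ := β)
    (a₁ := n) (a₂ := n) (fun h => hn (List.mem_append_left _ h))
    (fun h => hn (List.mem_append_right _ h))).1 e.symm
  obtain ⟨e₁, -, rfl⟩ := key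
  have hrr : ∀ {r₁ r₂ : ℕ} {α₁ α₂ : List ℕ}, (∀ x, x ∈ α₁ ++ β' ↔ 0 ≤ x ∧ x < 0 + r₁) →
      (∀ x, x ∈ α₂ ++ β' ↔ 0 ≤ x ∧ x < 0 + r₂) → (∀ x ∈ α₁, x + 1 ≠ r₁) → r₁ ≤ r₂ := by
    intro r₁ r₂ α₁ α₂ h₁ h₂ h₃
    by_contra hlt
    have h₄ := (h₁ (r₁ - 1)).2 (by omega)
    rcases List.mem_append.1 h₄ with h₅ | h₅
    · exact h₃ _ h₅ (by omega)
    · have := (h₂ (r₁ - 1)).1 (List.mem_append_right _ h₅)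
      omega
  obtain rfl : r = r' := le_antisymm (hrr g.2 g'.2 ht) (hrr g'.2 g.2 ht')
  have hl : α.length = α'.length := by
    have h₁ := length_of_mem_arrangements (mem_arrangements.2 g)
    have h₂ := length_of_mem_arrangements (mem_arrangements.2 g')
    simp at h₁ h₂
    omega
  obtain ⟨rfl, rfl⟩ := List.append_inj e₁ hl.symm
  simp

theorem card_markedSet_eq_sum_blockPairs (n i : ℕ) :
    (markedSet NoCondition 0 (n + 1) i).card = ∑ r ∈ Finset.range (n + 1),
      ∑ k ∈ Finset.range (r + 1), (blockPairs r n k (i - k)).card := by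
  simp only [← Finset.card_sigma]
  symm
  refine Finset.card_bij
    (fun x _ => x.2.2.1.take x.2.1 ++ (x.2.2.2 ++ n :: x.2.2.1.drop x.2.1)) ?_ ?_ ?_
  · rintro ⟨r, k, τ, γ⟩ h
    simp only [Finset.mem_sigma, Finset.mem_range, blockPairs, Finset.mem_filter,
      Finset.mem_product] at h
    obtain ⟨hr, hk, ⟨hτ, hγ⟩, h⟩ := h
    obtain ⟨α, β, rfl, rfl⟩ := exists_append_of_mem_topSet hτ
    simp only [List.take_left', List.drop_left'] at h ⊢
    exact insert_block_mem_markedSet (by omega) hτ hγ h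
  · rintro ⟨r, k, τ, γ⟩ h ⟨r', k', τ', γ'⟩ h' e
    simp only [Finset.mem_sigma, Finset.mem_range, blockPairs, Finset.mem_filter,
      Finset.mem_product] at h h'
    obtain ⟨hr, hk, ⟨hτ, hγ⟩, h⟩ := h
    obtain ⟨hr', hk', ⟨hτ', hγ'⟩, h'⟩ := h'
    obtain ⟨α, β, rfl, rfl⟩ := exists_append_of_mem_topSet hτ
    obtain ⟨α', β', rfl, rfl⟩ := exists_append_of_mem_topSet hτ'
    simp only [List.take_left', List.drop_left'] at e
    obtain ⟨rfl, rfl, rfl, rfl⟩ := insert_block_injective hτ hτ' (mem_blockSet.1 hγ).1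
      (mem_blockSet.1 hγ').1 (by omega) e
    rfl
  · intro w hw
    obtain ⟨r, hr, α, β, γ, rfl, hα, h₁, h₂, h₃⟩ := exists_block_of_mem_markedSet hw
    refine ⟨⟨r, α.length, α ++ β, γ⟩, ?_, by simp⟩
    simp only [Finset.mem_sigma, Finset.mem_range, blockPairs, Finset.mem_filter,
      Finset.mem_product]
    refine ⟨by omega, by omega, ⟨h₁, h₂⟩, by simpa using h₃⟩

/-! ### Cardinalities of the factors -/

theorem eq_range'_of_pairwise {lo n : ℕ} {w : List ℕ} (h : w ∈ arrangements lo n)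
    (hw : w.Pairwise (· < ·)) : w = List.range' lo n := by
  rw [arrangements, List.mem_toFinset, List.mem_permutations] at h
  exact h.eq_of_pairwise (fun a b _ _ h₁ h₂ => by omega) hw List.pairwise_lt_range'

theorem range'_mem_blockSet {r n j : ℕ} (hr : r ≤ n) (hj : j ≤ n - r + 1) :
    List.range' r (n - r) ∈ blockSet r n j := by
  refine mem_blockSet.2 ⟨?_, eggeAvoids_of_pairwise List.pairwise_lt_range', hj, ?_⟩
  · rw [arrangements, List.mem_toFinset, List.mem_permutations]
  · refine List.Pairwise.sublist (List.take_sublist _ _) (List.pairwise_append.2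
      ⟨List.pairwise_lt_range', by simp, fun x hx y hy => ?_⟩)
    rw [List.mem_singleton.1 hy]
    rw [List.mem_range'_1] at hx
    omega

/-- For j ≤ n - r the marks stay inside `γ`. For j = n - r + 1 they include `n`, which leaves only
the increasing `γ`. -/
theorem card_blockSet {r n : ℕ} (hr : r ≤ n) (j : ℕ) : (blockSet r n j).card =
    (markedSet NoCondition 0 (n - r) j).card + if j = n - r + 1 then 1 else 0 := by
  rcases lt_trichotomy j (n - r + 1) with hj | hj | hj
  · rw [if_neg hj.ne, add_zero, ← card_markedSet_shift (fun _ _ _ => Iff.rfl) r]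
    congr 1
    ext γ
    rw [mem_blockSet, mem_markedSet]
    refine and_congr_right fun h => and_congr_right fun _ => ?_
    rw [List.take_append_of_le_length (by rw [length_of_mem_arrangements h]; omega)]
    simp only [and_true]
    exact and_congr_left fun _ => by omega
  · rw [if_pos hj, markedSet_eq_empty (by omega), Finset.card_empty, zero_add,
      Finset.card_eq_one]
    refine ⟨List.range' r (n - r), Finset.eq_singleton_iff_unique_mem.2
      ⟨range'_mem_blockSet hr hj.le, fun γ h => ?_⟩⟩
    obtain ⟨h₁, -, -, h₂⟩ := mem_blockSet.1 h
    rw [List.take_of_length_le (by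
      rw [List.length_append, length_of_mem_arrangements h₁, hj]; simp)] at h₂
    exact eq_range'_of_pairwise h₁ (List.pairwise_append.1 h₂).1
  · rw [if_neg hj.ne', add_zero, markedSet_eq_empty (by omega), Finset.card_empty,
      Finset.card_eq_zero, Finset.eq_empty_iff_forall_notMem]
    intro γ h
    have := (mem_blockSet.1 h).2.2.1
    omega

open Classical in
theorem card_blockSet_filter_pairwise {r n : ℕ} (hr : r ≤ n) (j : ℕ) :
    ((blockSet r n j).filter fun γ => γ.Pairwise (· < ·)).card =
      if j ≤ n - r + 1 then 1 else 0 := by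
  split_ifs with hj
  · rw [Finset.card_eq_one]
    refine ⟨List.range' r (n - r), Finset.eq_singleton_iff_unique_mem.2
      ⟨Finset.mem_filter.2 ⟨range'_mem_blockSet hr hj, List.pairwise_lt_range'⟩, fun γ h => ?_⟩⟩
    obtain ⟨h₁, h₂⟩ := Finset.mem_filter.1 h
    exact eq_range'_of_pairwise (mem_blockSet.1 h₁).1 h₂
  · rw [Finset.card_eq_zero, Finset.eq_empty_iff_forall_notMem]
    intro γ h
    have := (mem_blockSet.1 (Finset.mem_filter.1 h).1).2.2.1
    omega

theorem mem_topSet_noneBetween {r k : ℕ} {w : List ℕ} : w ∈ topSet NoneBetween r k ↔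
    w ∈ topSet NoCondition r k ∧ NoneBetween (w.take k) (w.drop k) := by
  simp only [topSet, markedSet, Finset.mem_filter]
  tauto

/-- Inclusion–exclusion for the disjunction in `blockPairs`, with the intersection term moved to the
left to avoid subtraction in `ℕ`. -/
theorem card_blockPairs {r n : ℕ} (hr : r ≤ n) (k j : ℕ) :
    (blockPairs r n k j).card + (topSet NoneBetween r k).card * (if j ≤ n - r + 1 then 1 else 0) =
      (topSet NoCondition r k).card * (if j ≤ n - r + 1 then 1 else 0) +
      (topSet NoneBetween r k).card *
        ((markedSet NoCondition 0 (n - r) j).card + if j = n - r + 1 then 1 else 0) := by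
  classical
  rw [← card_blockSet hr, ← card_blockSet_filter_pairwise hr, ← Finset.card_product,
    ← Finset.card_product, ← Finset.card_product]
  refine Eq.trans ?_ (Finset.card_union_add_card_inter _ _)
  congr 2
  · ext ⟨τ, γ⟩
    simp only [blockPairs, Finset.mem_filter, Finset.mem_product, Finset.mem_union,
      mem_topSet_noneBetween]
    tauto
  · ext ⟨τ, γ⟩
    simp only [Finset.mem_filter, Finset.mem_product, Finset.mem_inter, mem_topSet_noneBetween]
    tauto

/-! ### The algebraic solution of the functional equation -/

/-- The rational parametrization of the solution of the functional equation. -/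
theorem functionalEquation_field {F : Type*} [Field F] {s u x C A A₁ K K₁ I G p D E M N V : F}
    (hs : s ≠ 0) (hp : p ≠ 0) (hD : D ≠ 0) (hE : E ≠ 0) (hM : M ≠ 0) (hN : N ≠ 0) (hV : V ≠ 0)
    (ep : p = 2 * s - 1) (eD : D = 2 * s ^ 2 - 2 * s + 1) (eE : E = s ^ 2 - s + 1)
    (eM : M = s * p - (s - 1) * u) (eN : N = s ^ 2 - (s - 1) * u)
    (eV : V = p * E - (s - 1) * (2 * s ^ 2 - s + 1) * u + (s - 1) ^ 2 * u ^ 2)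
    (ex : x = (s - 1) / (s * p)) (eC : C = p / s)
    (eA : A = p * (p * E - (s - 1) * s ^ 2 * u) / (s * V))
    (eA₁ : A₁ = p * (p * E - (s - 1) * s ^ 2) / (s * E))
    (eK : K = s * p / N) (eK₁ : K₁ = s * p / E) (eI : I = s * p / M) (eG : G = s * p / D) :
    (1 - u) * (A - 1) = x * ((1 - u) * ((1 - x * u) * K) * (A + u * I) +
      C * ((1 - x) * K₁ - (1 - x * u) * K) +
      (1 - u) * ((1 - x * u) * (A - K)) * (G * (1 + u * I)) +
      G * ((1 - x) * (A₁ - K₁) - (1 - x * u) * (A - K))) := by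
  -- In this form the factors 1 - xu and 1 - x cancel against the denominators of `I` and `G`. What
  -- remains after clearing denominators is a polynomial identity in s and u.
  have h₁ : 1 - x * u = M / (s * p) := by
    rw [ex, eM]; field_simp
  have h₁' : 1 - x = D / (s * p) := by
    rw [ex, eD]; field_simp; rw [ep]; ring
  rw [h₁, h₁', ex, eC, eA, eA₁, eK, eK₁, eI, eG]
  field_simp
  rw [eV, eM, eN, eE, eD, ep]
  ring

/-- `ℚ[u]⟦x⟧` is a domain but not a field, so the hypotheses are stated without division and the
identity is checked in the fraction field. -/
theorem functionalEquation_domain {R : Type*} [CommRing R] [IsDomain R]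
    {s u x C A A₁ K K₁ I G p D E M N V : R}
    (hs : s ≠ 0) (hp : p ≠ 0) (hD : D ≠ 0) (hE : E ≠ 0) (hM : M ≠ 0) (hN : N ≠ 0) (hV : V ≠ 0)
    (ep : p = 2 * s - 1) (eD : D = 2 * s ^ 2 - 2 * s + 1) (eE : E = s ^ 2 - s + 1)
    (eM : M = s * p - (s - 1) * u) (eN : N = s ^ 2 - (s - 1) * u)
    (eV : V = p * E - (s - 1) * (2 * s ^ 2 - s + 1) * u + (s - 1) ^ 2 * u ^ 2)
    (ex : x * (s * p) = s - 1) (eC : C * s = p)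
    (eA : A * (s * V) = p * (p * E - (s - 1) * s ^ 2 * u))
    (eA₁ : A₁ * (s * E) = p * (p * E - (s - 1) * s ^ 2))
    (eK : K * N = s * p) (eK₁ : K₁ * E = s * p) (eI : I * M = s * p) (eG : G * D = s * p) :
    (1 - u) * (A - 1) = x * ((1 - u) * ((1 - x * u) * K) * (A + u * I) +
      C * ((1 - x) * K₁ - (1 - x * u) * K) +
      (1 - u) * ((1 - x * u) * (A - K)) * (G * (1 + u * I)) +
      G * ((1 - x) * (A₁ - K₁) - (1 - x * u) * (A - K))) := by
  let f := algebraMap R (FractionRing R)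
  have hf : Function.Injective f := IsFractionRing.injective _ _
  have nz : ∀ {y}, y ≠ 0 → f y ≠ 0 := fun hy => (map_ne_zero_iff f hf).2 hy
  have e2 : f 2 = 2 := map_ofNat f 2
  apply hf
  simp only [map_mul, map_sub, map_add, map_one]
  refine functionalEquation_field (nz hs) (nz hp) (nz hD) (nz hE) (nz hM) (nz hN) (nz hV)
    (by simp [ep, e2]) (by simp [eD, e2]) (by simp [eE]) (by simp [eM]) (by simp [eN])
    (by simp [eV, e2]) ?_ ?_ ?_ ?_ ?_ ?_ ?_ ?_
  · rw [eq_div_iff (mul_ne_zero (nz hs) (nz hp))]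
    simpa using congrArg f ex
  · rw [eq_div_iff (nz hs)]
    simpa using congrArg f eC
  · rw [eq_div_iff (mul_ne_zero (nz hs) (nz hV))]
    simpa using congrArg f eA
  · rw [eq_div_iff (mul_ne_zero (nz hs) (nz hE))]
    simpa using congrArg f eA₁
  · rw [eq_div_iff (nz hN)]
    simpa using congrArg f eK
  · rw [eq_div_iff (nz hE)]
    simpa using congrArg f eK₁
  · rw [eq_div_iff (nz hM)]
    simpa using congrArg f eI
  · rw [eq_div_iff (nz hD)]
    simpa using congrArg f eG

/-! ### The functional equation in `ℚ[u]⟦x⟧` -/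

/-- Substitution of a constant for `u` in a power series over `ℚ[u]`. -/
noncomputable def substU (t : ℚ) : PowerSeries (Polynomial ℚ) →+* PowerSeries (Polynomial ℚ) :=
  PowerSeries.map (Polynomial.C.comp (Polynomial.evalRingHom t))

/-- The variable `u` of `ℚ[u]⟦x⟧`. -/
noncomputable def serU : PowerSeries (Polynomial ℚ) := PowerSeries.C Polynomial.X

/-- The series `∑ uⁿ xⁿ`. -/
noncomputable def serI : PowerSeries (Polynomial ℚ) :=
  PowerSeries.mk fun n => Polynomial.X ^ n

/-- The series `∑ xⁿ`. -/
noncomputable def serG : PowerSeries (Polynomial ℚ) := PowerSeries.mk 1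

theorem serI_mul : serI * (1 - PowerSeries.X * serU) = 1 := by
  ext n : 1
  rw [mul_sub, mul_one, ← mul_assoc, map_sub]
  cases n with
  | zero => simp [serI, serU]
  | succ n => simp [serI, serU, PowerSeries.coeff_mul_C, PowerSeries.coeff_succ_mul_X,
      PowerSeries.coeff_one, pow_succ]

theorem serG_mul : serG * (1 - PowerSeries.X) = 1 :=
  PowerSeries.mk_one_mul_one_sub_eq_one _

@[simp] theorem substU_X (t : ℚ) : substU t PowerSeries.X = PowerSeries.X := by
  simp [substU]

theorem substU_serU (t : ℚ) :
    substU t serU = PowerSeries.C (Polynomial.C t) := by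
  simp [substU, serU]

@[simp] theorem substU_zero_serU : substU 0 serU = 0 := by
  simp [substU_serU]

@[simp] theorem substU_one_serU : substU 1 serU = 1 := by
  simp [substU_serU]

/-- The functional equation for the series that enumerates permutations with an increasing marked
prefix, together with that of the auxiliary series `K`. -/
structure SolvesEquation (A K : PowerSeries (Polynomial ℚ)) : Prop where
  aux : K * (1 - PowerSeries.X * serU * substU 0 A) = substU 0 A
  main : (1 - serU) * (A - 1) = PowerSeries.X *
    ((1 - serU) * ((1 - PowerSeries.X * serU) * K) * (A + serU * serI) +
      substU 0 A * ((1 - PowerSeries.X) * substU 1 K - (1 - PowerSeries.X * serU) * K) +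
      (1 - serU) * ((1 - PowerSeries.X * serU) * (A - K)) * (serG * (1 + serU * serI)) +
      serG * ((1 - PowerSeries.X) * (substU 1 A - substU 1 K) -
        (1 - PowerSeries.X * serU) * (A - K)))

theorem isUnit_of_constantCoeff_eq_one {R : Type*} [CommRing R] {F : PowerSeries R}
    (h : PowerSeries.constantCoeff F = 1) : IsUnit F :=
  PowerSeries.isUnit_iff_constantCoeff.2 (by rw [h]; exact isUnit_one)

theorem X_pow_dvd_substU {n : ℕ} (t : ℚ) {F : PowerSeries (Polynomial ℚ)}
    (h : PowerSeries.X ^ n ∣ F) : PowerSeries.X ^ n ∣ substU t F := by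
  simpa using map_dvd (substU t) h

/-- If A ≡ B mod xⁿ, then K ≡ L by `aux`, whose factor is a unit. The right side of `main` has a
factor x, so (1 - u)(A - B) ≡ 0 mod xⁿ⁺¹, and 1 - u can be cancelled coefficientwise in `ℚ[u]`. -/
theorem SolvesEquation.unique {A K B L : PowerSeries (Polynomial ℚ)} (h : SolvesEquation A K)
    (h' : SolvesEquation B L) : A = B := by
  have key : ∀ n, PowerSeries.X ^ n ∣ A - B := by
    intro n
    induction n with
    | zero => simp
    | succ n ih =>
      set φ := Ideal.Quotient.mk (Ideal.span {(PowerSeries.X : PowerSeries (Polynomial ℚ)) ^ n})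
      have hφ : ∀ {F H : PowerSeries (Polynomial ℚ)},
          φ F = φ H ↔ PowerSeries.X ^ n ∣ F - H := by
        intro F H
        rw [Ideal.Quotient.mk_eq_mk_iff_sub_mem, Ideal.mem_span_singleton]
      have hs : ∀ t {F H : PowerSeries (Polynomial ℚ)}, φ F = φ H →
          φ (substU t F) = φ (substU t H) := by
        intro t F H e
        rw [hφ, ← map_sub]
        exact X_pow_dvd_substU t (hφ.1 e)
      have eA : φ A = φ B := hφ.2 ih
      have eK : φ K = φ L := by
        have hu : IsUnit (1 - PowerSeries.X * serU * substU 0 A) :=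
          isUnit_of_constantCoeff_eq_one (by simp)
        refine (hu.map φ).mul_right_cancel ?_
        rw [← map_mul, h.aux]
        simp only [map_sub, map_mul, map_one, hs 0 eA]
        rw [← map_one φ, ← map_mul, ← map_mul, ← map_sub, ← map_mul, h'.aux]
      have e := congrArg₂ (· - ·) h.main h'.main
      simp only [← mul_sub] at e
      obtain ⟨Z, hZ⟩ : PowerSeries.X ^ (n + 1) ∣ (1 - serU) * ((A - 1) - (B - 1)) := by
        rw [e, pow_succ']
        refine mul_dvd_mul_left _ (hφ.1 ?_)
        simp only [map_sub, map_mul, map_one, map_add, eA, eK, hs 0 eA, hs 1 eA, hs 1 eK]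
      rw [sub_sub_sub_cancel_right] at hZ
      rw [PowerSeries.X_pow_dvd_iff]
      intro m hm
      have hm' : PowerSeries.coeff m ((1 - serU) * (A - B)) = 0 :=
        PowerSeries.X_pow_dvd_iff.1 ⟨Z, hZ⟩ m hm
      have e₁ : (1 - serU) = PowerSeries.C (1 - Polynomial.X : Polynomial ℚ) := by simp [serU]
      rw [e₁, PowerSeries.coeff_C_mul] at hm'
      refine (mul_eq_zero.1 hm').resolve_left fun h0 => ?_
      have := congrArg (Polynomial.eval 0) h0
      simp at this
  rw [← sub_eq_zero]
  ext n : 1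
  simpa using PowerSeries.X_pow_dvd_iff.1 (key (n + 1)) n (Nat.lt_succ_self n)

/-- The functional equation determines the value of a solution at `u = 0`, in terms of the series
`s` with `x s (2 s - 1) = s - 1`. -/
theorem SolvesEquation.substU_zero_mul {A K s : PowerSeries (Polynomial ℚ)}
    (h : SolvesEquation A K) (hs : PowerSeries.X * s * (2 * s - 1) = s - 1)
    (hs₀ : PowerSeries.constantCoeff s = 1) (hst : ∀ t, substU t s = s) :
    substU 0 A * s = 2 * s - 1 := by
  set E := s ^ 2 - s + 1 with hE
  set p := 2 * s - 1 with hp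
  set V := p * E - (s - 1) * (2 * s ^ 2 - s + 1) * serU + (s - 1) ^ 2 * serU ^ 2 with hV
  set N := s ^ 2 - (s - 1) * serU with hN
  have h2c : PowerSeries.constantCoeff (2 : PowerSeries (Polynomial ℚ)) = 2 := map_ofNat _ 2
  have uE : IsUnit E := isUnit_of_constantCoeff_eq_one (by simp [hE, hs₀])
  have up : IsUnit p := isUnit_of_constantCoeff_eq_one (by simp [hp, hs₀, h2c]; norm_num)
  have us : IsUnit s := isUnit_of_constantCoeff_eq_one hs₀
  have uV : IsUnit V := isUnit_of_constantCoeff_eq_one (by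
    simp [hV, hE, hp, hs₀, h2c]; norm_num)
  have uN : IsUnit N := isUnit_of_constantCoeff_eq_one (by simp [hN, hs₀])
  have uD : IsUnit (2 * s ^ 2 - 2 * s + 1) :=
    isUnit_of_constantCoeff_eq_one (by simp [hs₀])
  have uM : IsUnit (s * p - (s - 1) * serU) :=
    isUnit_of_constantCoeff_eq_one (by simp [hp, hs₀, h2c]; norm_num)
  -- The candidates `A'` and `K'` exist because their denominators have constant coefficient 1.
  obtain ⟨A', hA'⟩ : ∃ A', A' * (s * V) = p * (p * E - (s - 1) * s ^ 2 * serU) := by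
    obtain ⟨w, hw⟩ := (us.mul uV).exists_left_inv
    exact ⟨p * (p * E - (s - 1) * s ^ 2 * serU) * w, by rw [mul_assoc, hw, mul_one]⟩
  obtain ⟨K', hK'⟩ : ∃ K', K' * N = s * p := by
    obtain ⟨w, hw⟩ := uN.exists_left_inv
    exact ⟨s * p * w, by rw [mul_assoc, hw, mul_one]⟩
  have hst2 : ∀ t, substU t 2 = 2 := fun t => map_ofNat _ 2
  have hE' : ∀ t, substU t E = E := fun t => by simp [hE, hst]
  have hp' : ∀ t, substU t p = p := fun t => by simp [hp, hst, hst2]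
  have hA₀ : substU 0 A' * s = p := by
    have := congrArg (substU 0) hA'
    simp only [map_mul, map_sub, map_add, map_pow, hst, hE', hp', hV, substU_zero_serU, map_one,
      hst2] at this
    refine (up.mul uE).mul_right_cancel ?_
    linear_combination this
  have hA₁ : substU 1 A' * (s * E) = p * (p * E - (s - 1) * s ^ 2) := by
    have := congrArg (substU 1) hA'
    simp only [map_mul, map_sub, map_add, map_pow, hst, hE', hp', hV, substU_one_serU, map_one,
      hst2] at this
    -- At u = 1 the denominator `V` collapses to `E`.
    rw [← mul_one ((s - 1) * s ^ 2), ← this, hp, hE]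
    ring
  have hK₁ : substU 1 K' * E = s * p := by
    have := congrArg (substU 1) hK'
    simp only [map_mul, map_sub, map_pow, hst, hp', hN, substU_one_serU, map_one] at this
    rw [← this, hE]
    ring
  have sol : SolvesEquation A' K' := by
    constructor
    · refine (us.mul us).mul_right_cancel ?_
      rw [hN] at hK'
      linear_combination hK' - K' * PowerSeries.X * serU * s * hA₀ - K' * serU * hs - s * hA₀
    · refine functionalEquation_domain us.ne_zero up.ne_zero uD.ne_zero uE.ne_zero uM.ne_zero
        uN.ne_zero uV.ne_zero hp rfl hE rfl hN hV ?_ hA₀ hA' hA₁ hK' hK₁ ?_ ?_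
      · rw [← mul_assoc, hs]
      · linear_combination (s * p) * serI_mul + serI * serU * hs
      · rw [hp]
        linear_combination (s * p) * serG_mul + serG * hs
  rw [h.unique sol, hA₀]

/-! ### The enumerating series solve the functional equation -/

/-- The polynomial `∑_{k < d} f k uᵏ`. -/
noncomputable def rowPoly (f : ℕ → ℚ) (d : ℕ) : Polynomial ℚ :=
  ∑ k ∈ Finset.range d, Polynomial.C (f k) * Polynomial.X ^ k

theorem rowPoly_succ (f : ℕ → ℚ) (d : ℕ) :
    rowPoly f (d + 1) = rowPoly f d + Polynomial.C (f d) * Polynomial.X ^ d :=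
  Finset.sum_range_succ _ _

theorem rowPoly_succ' (f : ℕ → ℚ) (d : ℕ) :
    rowPoly f (d + 1) = Polynomial.X * rowPoly (fun k => f (k + 1)) d + Polynomial.C (f 0) := by
  simp only [rowPoly, Finset.sum_range_succ', Finset.mul_sum, pow_zero, mul_one]
  congr 1
  exact Finset.sum_congr rfl fun k _ => by ring

theorem rowPoly_add (f g : ℕ → ℚ) (d : ℕ) :
    rowPoly (fun k => f k + g k) d = rowPoly f d + rowPoly g d := by
  simp [rowPoly, add_mul, Finset.sum_add_distrib]

theorem rowPoly_sub (f g : ℕ → ℚ) (d : ℕ) :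
    rowPoly (fun k => f k - g k) d = rowPoly f d - rowPoly g d := by
  simp [rowPoly, sub_mul, Finset.sum_sub_distrib]

theorem rowPoly_mul_left (c : ℚ) (f : ℕ → ℚ) (d : ℕ) :
    rowPoly (fun k => c * f k) d = Polynomial.C c * rowPoly f d := by
  simp [rowPoly, Finset.mul_sum, mul_assoc]

theorem rowPoly_sum {ι : Type*} (s : Finset ι) (f : ι → ℕ → ℚ) (d : ℕ) :
    rowPoly (fun k => ∑ r ∈ s, f r k) d = ∑ r ∈ s, rowPoly (f r) d := by
  simp only [rowPoly, map_sum, Finset.sum_mul]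
  exact Finset.sum_comm

theorem rowPoly_congr {f g : ℕ → ℚ} {d : ℕ} (h : ∀ k < d, f k = g k) :
    rowPoly f d = rowPoly g d :=
  Finset.sum_congr rfl fun k hk => by rw [h k (Finset.mem_range.1 hk)]

theorem rowPoly_of_le {f : ℕ → ℚ} {d e : ℕ} (h : d ≤ e) (hf : ∀ k, d ≤ k → f k = 0) :
    rowPoly f e = rowPoly f d := by
  symm
  refine Finset.sum_subset (by simpa using h) fun k _ hk => ?_
  rw [hf k (by simpa using hk)]
  simp

theorem eval_zero_rowPoly_succ (f : ℕ → ℚ) (d : ℕ) : (rowPoly f (d + 1)).eval 0 = f 0 := by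
  simp [rowPoly_succ']

/-- By truncation, the exponents i < k all receive `g 0`. They form a geometric sum, which the
factor 1 - u closes. -/
theorem one_sub_mul_rowPoly_shift {g : ℕ → ℚ} {k e N : ℕ} (hg : ∀ j, e ≤ j → g j = 0)
    (hN : k + e ≤ N) : (1 - Polynomial.X) * rowPoly (fun i => g (i - k)) N =
      Polynomial.C (g 0) * (1 - Polynomial.X ^ k) +
        (1 - Polynomial.X) * rowPoly g e * Polynomial.X ^ k := by
  obtain ⟨M, rfl⟩ := Nat.exists_eq_add_of_le (show k ≤ N by omega)
  have h : rowPoly (fun i => g (i - k)) (k + M) =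
      Polynomial.C (g 0) * ∑ i ∈ Finset.range k, Polynomial.X ^ i +
        rowPoly g M * Polynomial.X ^ k := by
    rw [rowPoly, Finset.sum_range_add, Finset.mul_sum, rowPoly, Finset.sum_mul]
    congr 1
    · refine Finset.sum_congr rfl fun i hi => ?_
      rw [Nat.sub_eq_zero_of_le (Finset.mem_range.1 hi).le]
    · refine Finset.sum_congr rfl fun i _ => ?_
      rw [Nat.add_sub_cancel_left]
      ring
  rw [h, rowPoly_of_le (by omega) hg, ← mul_neg_geom_sum]
  ring

/-- The boundary terms `f k * (1 - X ^ k)` add up to f(1) - f(u); this is how the value at u = 1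
enters the functional equation. -/
theorem one_sub_mul_rowPoly_conv {f g : ℕ → ℚ} {m e N : ℕ} (hg : ∀ j, e ≤ j → g j = 0)
    (hN : m + e ≤ N + 1) :
    (1 - Polynomial.X) * rowPoly (fun i => ∑ k ∈ Finset.range m, f k * g (i - k)) N =
      (1 - Polynomial.X) * (rowPoly f m * rowPoly g e) +
        (Polynomial.C ((rowPoly f m).eval 1) - rowPoly f m) * Polynomial.C (g 0) := by
  have h₁ : Polynomial.C ((rowPoly f m).eval 1) =
      ∑ k ∈ Finset.range m, Polynomial.C (f k) := by
    simp [rowPoly, Polynomial.eval_finsetSum]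
  have h₂ : rowPoly f m = ∑ k ∈ Finset.range m, Polynomial.C (f k) * Polynomial.X ^ k := rfl
  rw [rowPoly_sum, h₁, h₂, Finset.mul_sum, Finset.sum_mul, Finset.mul_sum,
    ← Finset.sum_sub_distrib, Finset.sum_mul, ← Finset.sum_add_distrib]
  refine Finset.sum_congr rfl fun k hk => ?_
  have hk := Finset.mem_range.1 hk
  rw [rowPoly_mul_left, mul_left_comm, one_sub_mul_rowPoly_shift hg (by omega)]
  ring

/-- The number of class members of length `n` whose prefix of length `k` is increasing and
satisfies `R`. -/
noncomputable def markedCount (R : List ℕ → List ℕ → Prop) (n k : ℕ) : ℚ :=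
  (markedSet R 0 n k).card

/-- The number of elements of `topSet R n k`. -/
noncomputable def topCount (R : List ℕ → List ℕ → Prop) (n k : ℕ) : ℚ :=
  (topSet R n k).card

/-- The number of blocks of length `b + 1` with an increasing prefix of length `j`. -/
noncomputable def blockCount (b j : ℕ) : ℚ :=
  markedCount NoCondition b j + if j = b + 1 then 1 else 0

/-- The number of increasing blocks of length `b + 1`, with a marked prefix of length `j`. -/
def incBlockCount (b j : ℕ) : ℚ := if j ≤ b + 1 then 1 else 0

theorem markedCount_eq_zero {R : List ℕ → List ℕ → Prop} {n k : ℕ} (h : n < k) :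
    markedCount R n k = 0 := by
  rw [markedCount, markedSet_eq_empty h]
  simp

theorem markedCount_succ_eq_sum (n i : ℕ) : markedCount NoCondition (n + 1) i =
    ∑ r ∈ Finset.range (n + 1),
      (∑ k ∈ Finset.range (r + 1), topCount NoneBetween r k * blockCount (n - r) (i - k) +
      ∑ k ∈ Finset.range (r + 1), (topCount NoCondition r k - topCount NoneBetween r k) *
        incBlockCount (n - r) (i - k)) := by
  rw [markedCount, card_markedSet_eq_sum_blockPairs, Nat.cast_sum]
  refine Finset.sum_congr rfl fun r hr => ?_
  rw [Nat.cast_sum, ← Finset.sum_add_distrib]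
  refine Finset.sum_congr rfl fun k _ => ?_
  have h := congrArg (Nat.cast : ℕ → ℚ)
    (card_blockPairs (Nat.lt_succ_iff.1 (Finset.mem_range.1 hr)) k (i - k))
  push_cast at h
  rw [blockCount, incBlockCount, topCount, topCount, markedCount]
  linear_combination h

/-- The series `∑ f n k uᵏ xⁿ`, summed over `k < n + d`. -/
noncomputable def rowSeries (f : ℕ → ℕ → ℚ) (d : ℕ) : PowerSeries (Polynomial ℚ) :=
  PowerSeries.mk fun n => rowPoly (f n) (n + d)

theorem coeff_rowSeries (f : ℕ → ℕ → ℚ) (d n : ℕ) :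
    PowerSeries.coeff n (rowSeries f d) = rowPoly (f n) (n + d) := PowerSeries.coeff_mk _ _

theorem coeff_substU (t : ℚ) (F : PowerSeries (Polynomial ℚ)) (n : ℕ) :
    PowerSeries.coeff n (substU t F) = Polynomial.C ((PowerSeries.coeff n F).eval t) := by
  simp [substU]

theorem one_sub_serU : 1 - serU = PowerSeries.C (1 - Polynomial.X : Polynomial ℚ) := by
  simp [serU]

theorem markedCount_zero_zero : markedCount NoCondition 0 0 = 1 := by
  have : markedSet NoCondition 0 0 0 = {[]} := by
    ext w
    rw [mem_markedSet_zero, mem_arrangements, Finset.mem_singleton]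
    constructor
    · rintro ⟨⟨-, h⟩, -⟩
      exact List.eq_nil_iff_forall_not_mem.2 fun x hx => by have := (h x).1 hx; omega
    · rintro rfl
      exact ⟨by simp, eggeAvoids_nil⟩
  rw [markedCount, this]
  simp

/-- Each truncated convolution becomes a product and a boundary term. The boundary term needs the
number of blocks without marks: this is A at u = 0 for all blocks, and 1 in each length for
increasing ones. Block rows have one more entry than their index suggests, since `n` can be marked
too; hence the argument 2. -/
theorem rowSeries_functional_equation :
    (1 - serU) * (rowSeries (markedCount NoCondition) 1 - 1) = PowerSeries.X *
      ((1 - serU) * (rowSeries (topCount NoneBetween) 1 * rowSeries blockCount 2) +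
        (substU 1 (rowSeries (topCount NoneBetween) 1) - rowSeries (topCount NoneBetween) 1) *
          substU 0 (rowSeries (markedCount NoCondition) 1) +
        ((1 - serU) * ((rowSeries (topCount NoCondition) 1 - rowSeries (topCount NoneBetween) 1) *
          rowSeries incBlockCount 2) +
        (substU 1 (rowSeries (topCount NoCondition) 1 - rowSeries (topCount NoneBetween) 1) -
          (rowSeries (topCount NoCondition) 1 - rowSeries (topCount NoneBetween) 1)) * serG)) := by
  ext n : 1
  rw [one_sub_serU]
  cases n with
  | zero =>
    rw [PowerSeries.coeff_C_mul, PowerSeries.coeff_zero_X_mul, map_sub, coeff_rowSeries,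
      rowPoly_succ]
    simp [markedCount_zero_zero, rowPoly]
  | succ n =>
    have e : rowSeries (topCount NoCondition) 1 - rowSeries (topCount NoneBetween) 1 =
        rowSeries (fun r k => topCount NoCondition r k - topCount NoneBetween r k) 1 := by
      ext r : 1
      simp only [map_sub, coeff_rowSeries]
      rw [rowPoly_sub]
    rw [e, PowerSeries.coeff_C_mul, PowerSeries.coeff_succ_X_mul]
    simp only [map_add, PowerSeries.coeff_C_mul]
    simp only [map_sub, PowerSeries.coeff_mul, coeff_rowSeries,
      coeff_substU, Finset.mul_sum, ← Finset.sum_add_distrib, PowerSeries.coeff_one,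
      Nat.succ_ne_zero, if_false, sub_zero]
    rw [Finset.Nat.sum_antidiagonal_eq_sum_range_succ_mk,
      rowPoly_congr (fun i _ => markedCount_succ_eq_sum n i), rowPoly_sum, Finset.mul_sum]
    refine Finset.sum_congr rfl fun r hr => ?_
    have hr := Finset.mem_range.1 hr
    rw [rowPoly_add, mul_add,
      one_sub_mul_rowPoly_conv (g := blockCount (n - r)) (e := n - r + 2) ?_ (by omega),
      one_sub_mul_rowPoly_conv (g := incBlockCount (n - r)) (e := n - r + 2) ?_ (by omega)]
    · rw [eval_zero_rowPoly_succ]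
      simp [blockCount, incBlockCount, serG]
    · intro j hj
      rw [incBlockCount, if_neg (by omega)]
    · intro j hj
      rw [blockCount, if_neg (by omega), markedCount_eq_zero (by omega), add_zero]

theorem rowSeries_topCount {R : List ℕ → List ℕ → Prop}
    (hR : ∀ α β m, (∀ x ∈ α ++ β, x < m) → (R (α ++ [m]) β ↔ R α β)) :
    rowSeries (topCount R) 1 = (1 - PowerSeries.X * serU) * rowSeries (markedCount R) 1 := by
  ext n : 1
  rw [sub_mul, one_mul, map_sub, mul_assoc]
  cases n with
  | zero =>
    simp [coeff_rowSeries, rowPoly, topCount, markedCount, topSet_zero_right]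
  | succ n =>
    rw [PowerSeries.coeff_succ_X_mul, serU, PowerSeries.coeff_C_mul, coeff_rowSeries,
      coeff_rowSeries, coeff_rowSeries, rowPoly_succ', rowPoly_succ' (markedCount R (n + 1)),
      topCount, topSet_zero_right, ← markedCount, add_sub_right_comm, ← mul_sub, ← rowPoly_sub]
    congr 2
    refine rowPoly_congr fun k _ => ?_
    have := congrArg (Nat.cast : ℕ → ℚ) (card_topSet_succ hR n k)
    push_cast at this
    rw [topCount, markedCount, markedCount]
    linear_combination this

theorem rowSeries_blockCount :
    rowSeries blockCount 2 = rowSeries (markedCount NoCondition) 1 + serU * serI := by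
  ext n : 1
  have h : rowPoly (blockCount n) (n + 1) = rowPoly (markedCount NoCondition n) (n + 1) :=
    rowPoly_congr fun k hk => by rw [blockCount, if_neg (by omega), add_zero]
  rw [map_add, coeff_rowSeries, coeff_rowSeries, rowPoly_succ, h, serU, PowerSeries.coeff_C_mul,
    serI, PowerSeries.coeff_mk, blockCount, if_pos rfl, markedCount_eq_zero (by omega)]
  simp [pow_succ']

/-- Consecutive rows differ by the single term uⁿ⁺¹, so multiplication by 1 - x telescopes. -/
theorem rowSeries_incBlockCount :
    rowSeries incBlockCount 2 = serG * (1 + serU * serI) := by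
  have h : rowSeries incBlockCount 2 * (1 - PowerSeries.X) = 1 + serU * serI := by
    ext n : 1
    rw [mul_sub, mul_one, map_sub, map_add, serU, PowerSeries.coeff_C_mul, serI,
      PowerSeries.coeff_mk, coeff_rowSeries]
    cases n with
    | zero => simp [rowPoly, incBlockCount, Finset.sum_range_succ]
    | succ n =>
      rw [PowerSeries.coeff_succ_mul_X, coeff_rowSeries, rowPoly_succ,
        rowPoly_congr (g := incBlockCount n) fun k hk => by
          rw [incBlockCount, incBlockCount, if_pos (by omega), if_pos (by omega)]]
      simp [incBlockCount, PowerSeries.coeff_one, pow_succ']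
  calc rowSeries incBlockCount 2
      = rowSeries incBlockCount 2 * (1 - PowerSeries.X) * serG := by
        rw [mul_assoc, mul_comm (1 - PowerSeries.X), serG_mul, mul_one]
    _ = _ := by rw [h, mul_comm]

theorem noneBetween_append_max {α β : List ℕ} {m : ℕ} (h : ∀ x ∈ α ++ β, x < m) :
    NoneBetween (α ++ [m]) β ↔ NoneBetween α β := by
  constructor
  · intro h' a ha
    exact h' a (by simp [ha])
  · intro h' a ha b c hs hba hac
    rcases List.mem_append.1 ha with ha | ha
    · exact h' a ha b c hs hba hac
    · have := h c (List.mem_append_right _ (hs.subset (by simp)))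
      have := List.mem_singleton.1 ha
      omega

theorem markedCount_noneBetween_zero (n : ℕ) :
    markedCount NoneBetween n 0 = markedCount NoCondition n 0 := by
  rw [markedCount, markedCount]
  congr 2
  ext w
  simp [mem_markedSet, NoneBetween]

theorem rowSeries_noneBetween :
    rowSeries (markedCount NoneBetween) 1 *
      (1 - PowerSeries.X * serU * substU 0 (rowSeries (markedCount NoCondition) 1)) =
      substU 0 (rowSeries (markedCount NoCondition) 1) := by
  suffices h : rowSeries (markedCount NoneBetween) 1 =
      substU 0 (rowSeries (markedCount NoCondition) 1) + PowerSeries.X * (serU *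
        (substU 0 (rowSeries (markedCount NoCondition) 1) *
          rowSeries (markedCount NoneBetween) 1)) by
    linear_combination h
  ext n : 1
  rw [map_add, coeff_substU, coeff_rowSeries, coeff_rowSeries, eval_zero_rowPoly_succ]
  cases n with
  | zero => simp [rowPoly, markedCount_noneBetween_zero]
  | succ n =>
    rw [PowerSeries.coeff_succ_X_mul, serU, PowerSeries.coeff_C_mul, PowerSeries.coeff_mul,
      rowPoly_succ', markedCount_noneBetween_zero, add_comm]
    congr 2
    simp only [coeff_substU, coeff_rowSeries, eval_zero_rowPoly_succ]
    rw [Finset.Nat.sum_antidiagonal_eq_sum_range_succ_mk,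
      rowPoly_congr (g := fun k => ∑ d ∈ Finset.range (n + 1),
        markedCount NoCondition d 0 * markedCount NoneBetween (n - d) k) ?_, rowPoly_sum]
    · refine Finset.sum_congr rfl fun d hd => ?_
      rw [rowPoly_mul_left, rowPoly_of_le (d := n - d + 1) (by omega)
        fun k hk => markedCount_eq_zero (by omega)]
    · intro k _
      simp only [markedCount]
      rw [card_markedSet_noneBetween_succ]
      push_cast
      rfl

theorem solvesEquation_rowSeries :
    SolvesEquation (rowSeries (markedCount NoCondition) 1)
      (rowSeries (markedCount NoneBetween) 1) := by
  refine ⟨rowSeries_noneBetween, ?_⟩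
  rw [rowSeries_functional_equation, rowSeries_topCount (R := NoCondition) (fun _ _ _ _ => Iff.rfl),
    rowSeries_topCount (R := NoneBetween) (fun _ _ _ => noneBetween_append_max),
    rowSeries_blockCount, rowSeries_incBlockCount]
  simp only [map_mul, map_sub, map_one, substU_X, substU_one_serU, mul_one]
  ring

/-! ### Permutations as lists -/

theorem ofFn_sublist_ofFn {k n : ℕ} {x : Fin k → ℕ} {y : Fin n → ℕ} :
    (List.ofFn x).Sublist (List.ofFn y) ↔
      ∃ f : Fin k → Fin n, StrictMono f ∧ ∀ i, x i = y (f i) := by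
  rw [List.sublist_iff_exists_fin_orderEmbedding_get_eq]
  constructor
  · rintro ⟨f, hf⟩
    refine ⟨fun i => (f (i.cast (by simp))).cast (by simp), fun i j hij => ?_, fun i => ?_⟩
    · simpa using hij
    · have := hf (i.cast (by simp))
      simp only [List.get_ofFn] at this
      exact this
  · rintro ⟨f, hf, h⟩
    refine ⟨OrderEmbedding.ofStrictMono
      (fun i => (f (i.cast (by simp))).cast (by simp)) fun i j hij => ?_, fun i => ?_⟩
    · have : f (i.cast (by simp)) < f (j.cast (by simp)) := hf (by simpa using hij)
      simpa using this
    · simp only [List.get_ofFn]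
      exact h (i.cast (by simp))

/-- The one-line notation of a permutation. -/
def oneLine {n : ℕ} (π : Equiv.Perm (Fin n)) : List ℕ := List.ofFn fun i => (π i : ℕ)

/-- `y` lists the values of an occurrence in increasing order, that is, y = π ∘ f ∘ τ⁻¹. -/
theorem containsPattern_iff {n k : ℕ} {π : Equiv.Perm (Fin n)} {τ : Equiv.Perm (Fin k)} :
    ContainsPattern π τ ↔ ∃ y : Fin k → ℕ, StrictMono y ∧
      (List.ofFn fun i => y (τ i)).Sublist (oneLine π) := by
  simp only [oneLine, ofFn_sublist_ofFn]
  constructor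
  · rintro ⟨f, hf, h⟩
    refine ⟨fun i => π (f (τ.symm i)), fun i j hij => ?_, f, hf, fun i => by simp⟩
    have := (h (τ.symm i) (τ.symm j)).2 (by simpa using hij)
    simpa using this
  · rintro ⟨y, hy, f, hf, h⟩
    refine ⟨f, hf, fun i j => ?_⟩
    rw [Fin.lt_def, ← h, ← h, hy.lt_iff_lt]

theorem eggeAvoids_oneLine {n : ℕ} {π : Equiv.Perm (Fin n)} :
    EggeAvoids (oneLine π) ↔ π ∈ Av n eggeBasis := by
  simp only [Av, eggeBasis, Set.mem_ofPred_eq, Set.mem_insert_iff, Set.mem_singleton_iff,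
    forall_eq_or_imp, forall_eq, containsPattern_iff]
  constructor
  · intro h
    refine ⟨?_, ?_, ?_⟩
    · rintro ⟨y, hy, hs⟩
      -- `List.ofFn` over the concrete pattern unfolds by definition to the list in the structure
      -- field.
      exact h.avoids2143 (y 0) (y 1) (y 2) (y 3) hs (hy (by decide)) (hy (by decide))
        (hy (by decide))
    · rintro ⟨y, hy, hs⟩
      exact h.avoids3142 (y 0) (y 1) (y 2) (y 3) hs (hy (by decide)) (hy (by decide))
        (hy (by decide))
    · rintro ⟨y, hy, hs⟩
      exact h.avoids254613 (y 0) (y 1) (y 2) (y 3) (y 4) (y 5) hs (hy (by decide))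
        (hy (by decide)) (hy (by decide)) (hy (by decide)) (hy (by decide))
  · rintro ⟨h₁, h₂, h₃⟩
    refine ⟨fun a b c d hs hab hbc hcd => h₁ ⟨![a, b, c, d], ?_, hs⟩,
      fun a b c d hs hab hbc hcd => h₂ ⟨![a, b, c, d], ?_, hs⟩,
      fun a b c d e f hs hab hbc hcd hde hef => h₃ ⟨![a, b, c, d, e, f], ?_, hs⟩⟩ <;>
    simp [Fin.strictMono_iff_lt_succ, Fin.forall_fin_succ, *]

theorem oneLine_injective {n : ℕ} :
    Function.Injective (oneLine : Equiv.Perm (Fin n) → List ℕ) := by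
  intro π σ h
  ext i
  exact congrFun (List.ofFn_injective h) i

theorem oneLine_mem_arrangements {n : ℕ} (π : Equiv.Perm (Fin n)) :
    oneLine π ∈ arrangements 0 n := by
  rw [mem_arrangements, oneLine, List.nodup_ofFn]
  refine ⟨Fin.val_injective.comp π.injective, fun x => ?_⟩
  rw [List.mem_ofFn]
  constructor
  · rintro ⟨i, rfl⟩
    have := (π i).isLt
    omega
  · intro hx
    exact ⟨π.symm ⟨x, by omega⟩, by simp⟩

theorem exists_oneLine_eq {n : ℕ} {w : List ℕ} (h : w ∈ arrangements 0 n) :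
    ∃ π : Equiv.Perm (Fin n), oneLine π = w := by
  obtain rfl := length_of_mem_arrangements h
  obtain ⟨hnd, hmem⟩ := mem_arrangements.1 h
  have hlt : ∀ i, w.get i < w.length := fun i => by
    have := (hmem _).1 (List.get_mem w i)
    omega
  have hinj : Function.Injective fun i => (⟨w.get i, hlt i⟩ : Fin w.length) := by
    intro i j e
    exact hnd.injective_get (Fin.mk.inj_iff.1 e)
  refine ⟨Equiv.ofBijective _ (Finite.injective_iff_bijective.1 hinj), ?_⟩
  simp only [oneLine, Equiv.ofBijective_apply]
  exact List.ofFn_get w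

theorem ncard_Av (n : ℕ) :
    (Av n eggeBasis).ncard = (markedSet NoCondition 0 n 0).card := by
  rw [← Set.ncard_image_of_injective _ oneLine_injective, ← Set.ncard_coe_finset]
  congr 1
  ext w
  rw [Finset.mem_coe, mem_markedSet_zero, Set.mem_image]
  constructor
  · rintro ⟨π, hπ, rfl⟩
    exact ⟨oneLine_mem_arrangements π, eggeAvoids_oneLine.2 hπ⟩
  · rintro ⟨h₁, h₂⟩
    obtain ⟨π, rfl⟩ := exists_oneLine_eq h₁
    exact ⟨π, eggeAvoids_oneLine.1 h₂, rfl⟩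

/-! ### The main theorem -/

/-- The generating function of the large Schröder numbers over `ℚ`. -/
noncomputable def schroderSeries : PowerSeries ℚ :=
  PowerSeries.mk fun n => (Nat.largeSchroder n : ℚ)

theorem schroderSeries_eq :
    schroderSeries = 1 + PowerSeries.X * schroderSeries + PowerSeries.X * schroderSeries ^ 2 := by
  have e : PowerSeries.map (Nat.castRingHom ℚ) PowerSeries.largeSchroderSeries =
      schroderSeries := by
    ext n
    simp [schroderSeries]
  have h := congrArg (PowerSeries.map (Nat.castRingHom ℚ))
    PowerSeries.largeSchroderSeries_eq_one_add_X_mul_largeSchroderSeries_add_X_mul_largeSchroderSeries_sq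
  simpa only [map_add, map_mul, map_pow, map_one, PowerSeries.map_X, e] using h

/-- For s = (1 + l)/2 the equation x s (2s - 1) = s - 1 is the Schröder equation for l. Then C = (2s
- 1)/s = 2l/(1 + l), and (1 + x l)(1 + l) = 2l by the same equation. -/
theorem substU_rowSeries_eq :
    substU 0 (rowSeries (markedCount NoCondition) 1) =
      1 + PowerSeries.X * PowerSeries.map Polynomial.C schroderSeries := by
  set l := PowerSeries.map (Polynomial.C : ℚ →+* Polynomial ℚ) schroderSeries with hl
  have hle : l = 1 + PowerSeries.X * l + PowerSeries.X * l ^ 2 := by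
    have h := congrArg (PowerSeries.map (Polynomial.C : ℚ →+* Polynomial ℚ)) schroderSeries_eq
    simpa only [map_add, map_mul, map_pow, map_one, PowerSeries.map_X] using h
  have hl₀ : PowerSeries.constantCoeff l = 1 := by
    rw [hle]
    simp
  set h : PowerSeries (Polynomial ℚ) := PowerSeries.C (Polynomial.C (1 / 2)) with hh
  have h2 : 2 * h = 1 := by
    have : (2 : PowerSeries (Polynomial ℚ)) = PowerSeries.C (Polynomial.C 2) := by
      rw [map_ofNat, map_ofNat]
    rw [this, hh, ← map_mul, ← map_mul]
    norm_num
  have key := solvesEquation_rowSeries.substU_zero_mul (s := h * (1 + l)) ?_ ?_ ?_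
  · have hne : 1 + l ≠ 0 := by
      intro h0
      have := congrArg PowerSeries.constantCoeff h0
      simp [hl₀] at this
    refine mul_right_cancel₀ hne ?_
    generalize substU 0 (rowSeries (markedCount NoCondition) 1) = c at key ⊢
    linear_combination 2 * key + (2 * (1 + l) - c * (1 + l)) * h2 + hle
  · linear_combination (PowerSeries.X * h * (1 + l) ^ 2 - 1) * h2 - h * hle
  · have : PowerSeries.constantCoeff h = Polynomial.C (1 / 2) := by simp [hh]
    rw [map_mul, map_add, map_one, hl₀, this, ← Polynomial.C_1, ← map_add, ← map_mul]
    norm_num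
  · intro t
    ext n : 1
    have e : h * (1 + l) = PowerSeries.map Polynomial.C (PowerSeries.C (1 / 2) *
        (1 + schroderSeries)) := by
      simp [hh, hl]
    rw [e, coeff_substU, PowerSeries.coeff_map, Polynomial.eval_C]

theorem ncard_Av_succ (n : ℕ) : (Av (n + 1) eggeBasis).ncard = Nat.largeSchroder n := by
  have h := congrArg (PowerSeries.coeff (n + 1)) substU_rowSeries_eq
  rw [coeff_substU, coeff_rowSeries, eval_zero_rowPoly_succ, map_add, PowerSeries.coeff_succ_X_mul,
    PowerSeries.coeff_map, PowerSeries.coeff_one, if_neg (Nat.succ_ne_zero n), zero_add] at h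
  have := Polynomial.C_injective h
  rw [schroderSeries, PowerSeries.coeff_mk, markedCount, ← ncard_Av] at this
  exact_mod_cast this

theorem ncard_Av_zero : (Av 0 eggeBasis).ncard = 1 := by
  have := markedCount_zero_zero
  rw [markedCount] at this
  rw [ncard_Av]
  exact_mod_cast this

theorem eggeGF_eq : eggeGF = 1 + PowerSeries.X * schroderSeries := by
  ext n
  rw [eggeGF, PowerSeries.coeff_mk, map_add]
  cases n with
  | zero => simp [ncard_Av_zero]
  | succ n => simp [ncard_Av_succ, PowerSeries.coeff_succ_X_mul, PowerSeries.coeff_one,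
      schroderSeries]

theorem mainTheorem1 :
    (∃ R : PowerSeries ℚ,
      IsSqrtSeries (1 - 6 * PowerSeries.X + PowerSeries.X ^ 2) R ∧
      eggeGF = PowerSeries.C (1 / 2 : ℚ) * (3 - PowerSeries.X - R)) ∧
    (Av 0 eggeBasis).ncard = 1 ∧
    (∀ n : ℕ, (Av (n + 1) eggeBasis).ncard = Nat.largeSchroder n) := by
  -- The Schröder equation is quadratic in the series, with discriminant (1 - x)² - 4x = 1 - 6x +
  -- x²; the witness is the root of this discriminant obtained by completing the square.
  refine ⟨⟨1 - PowerSeries.X - 2 * (PowerSeries.X * schroderSeries), ⟨by simp, ?_⟩, ?_⟩,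
    ncard_Av_zero, ncard_Av_succ⟩
  · linear_combination -4 * PowerSeries.X * schroderSeries_eq
  · have h : PowerSeries.C (1 / 2 : ℚ) * 2 = 1 := by
      have : (2 : PowerSeries ℚ) = PowerSeries.C 2 := (map_ofNat _ 2).symm
      rw [this, ← map_mul]
      norm_num
    rw [eggeGF_eq]
    linear_combination (-(1 + PowerSeries.X * schroderSeries)) * h
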